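/- **Setting.** Let $\mathbb T^3=\mathbb R^3/\mathbb Z^3$ and let $H$ be the closure in $L^2(\mathbb T^3,\mathbb R^3)$ of the smooth divergence-free vector fields. Let $A=-\mathbf P\Delta$ be the Stokes operator on $H$, where $\mathbf P$ is the Leray projection; $H$ has an orthonormal basis of eigenvectors of $A$ of the form $u\cos(2\pi k\cdot x)$ or $u\sin(2\pi k\cdot x)$ with $k\in\mathbb Z^3$, $u\cdot k=0$, and eigenvalue $4\pi^2|k|^2$. For $m\in\mathbb N$ let $P_m$ be the orthogonal projection of $H$ onto the span of those with $|k|\le m$. Fix $\beta>\frac54$ and, for $\delta\ge 0$, set $Q_\delta:=(I+\delta A^{2\beta})^{-1}$. Write $\mathcal G(u,Q)$ for the Gaussian distribution on $H$ with mean $u$ and covariance operator $Q$. A family $(\mu^\epsilon)_{\epsilon>0}$ of probability measures on $H$ is said to *satisfy Assumption 1 with rate function $\mathcal I_0:H\to[0,\infty]$* if 1. for every weakly closed $A\subset H$, $\ \limsup_{\epsilon\downarrow0}\epsilon\log\mu^\epsilon(A)\le-\inf_{A}\mathcal I_0$; 2. for every norm-open $U\subset H$, $\ \liminf_{\epsilon\downarrow0}\epsilon\log\mu^\epsilon(U)\ge-\inf_{U}\mathcal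 I_0$; 3. $\mathcal I_0$ is continuous in the norm topology of $H$ and has a unique zero $u_0^\star$; 4. with $Z(\eta):=\limsup_{\epsilon\downarrow0}\epsilon\log\int_H\exp\left(\eta\|v\|_H^2/\epsilon\right)\mu^\epsilon(dv)\in[-\infty,\infty]$, $Z(\eta)$ is finite for all sufficiently small $\eta>0$, and $\limsup_{\eta\to0}Z(\eta)/\eta\le\|u_0^\star\|_H^2$, where $\eta\to 0$ through nonzero real values of either sign. **Lemma 1.2.** Let $u_0\in H$. (i) Let $\delta=\delta(\epsilon)>0$ satisfy $\delta(\epsilon)\to0$ and $\epsilon\,\delta(\epsilon)^{-5/(4\beta)}\to0$ as $\epsilon\downarrow0$. Then the Gaussian distributions $\mu^\epsilon=\mathcal G(u_0,\epsilon Q_{\delta(\epsilon)}/2)$ exist for all $\epsilon>0$ and satisfy Assumption 1 with rate function $\mathcal I_0(v)=\|v-u_0\|_H^2$. (ii) Let $\delta=\delta(\epsilon)\ge0$ and $m=m(\epsilon)\in\mathbb N$ satisfy $\delta(\epsilon)\to0$, $m(\epsilon)\to\infty$ and $\epsilon\min\left(m(\epsilon)^5,\delta(\epsilon)^{-5/(4\beta)}\right)\to0$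 as $\epsilon\downarrow0$, where $0^{-5/(4\beta)}:=\infty$. Then the Gaussian distributions $\mu^\epsilon=\mathcal G(P_{m(\epsilon)}u_0,\epsilon P_{m(\epsilon)}Q_{\delta(\epsilon)}/2)$ exist for all $\epsilon>0$ and satisfy Assumption 1 with the same rate function $\mathcal I_0(v)=\|v-u_0\|_H^2$. -/

import Mathlib

open Filter Topology MeasureTheory ProbabilityTheory
open scoped ENNReal ContDiff RealInnerProductSpace

noncomputable section

/-! ### Divergence-free vector fields on the torus -/

/-- The three-dimensional torus `𝕋³ = ℝ³ / ℤ³`. -/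
abbrev Torus3 : Type := UnitAddTorus (Fin 3)

/-- `ℝ³` with the Euclidean norm. -/
abbrev R3 : Type := EuclideanSpace ℝ (Fin 3)

/-- The normalised Lebesgue (Haar) measure on `𝕋³`. -/
abbrev torusMeasure : Measure Torus3 :=
  Measure.pi fun _ : Fin 3 => (AddCircle.haarAddCircle : Measure UnitAddCircle)

/-- `L²(𝕋³, ℝ³)`. -/
abbrev L2Field : Type := Lp R3 2 torusMeasure

/-- The `ℤ³`-periodic function on `ℝ³` that corresponds to a function on `𝕋³`. Derivatives of
functions on the torus are computed on this periodic function. -/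
def periodicLift (φ : Torus3 → R3) : R3 → R3 :=
  fun x => φ fun i => (x i : UnitAddCircle)

/-- The divergence `∑ᵢ ∂ᵢ fᵢ` of a vector field on `ℝ³`. -/
def divergence (f : R3 → R3) (x : R3) : ℝ :=
  ∑ i : Fin 3, fderiv ℝ f x (EuclideanSpace.single i 1) i

/-- `φ` is a smooth divergence-free vector field on `𝕋³`. -/
structure IsSmoothSolenoidal (φ : Torus3 → R3) : Prop where
  smooth : ContDiff ℝ ∞ (periodicLift φ)
  div_eq_zero : ∀ x, divergence (periodicLift φ) x = 0

/-- The space `H`: the closure in `L²(𝕋³, ℝ³)` of the smooth divergence-free fields. -/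
def solenoidalSubmodule : Submodule ℝ L2Field :=
  (Submodule.span ℝ
    {f : L2Field | ∃ φ, IsSmoothSolenoidal φ ∧ f =ᵐ[torusMeasure] φ}).topologicalClosure

/-- The Hilbert space `H`, with the norm and inner product of `L²(𝕋³, ℝ³)`. -/
abbrev SolenoidalSpace : Type := solenoidalSubmodule

instance : CompleteSpace SolenoidalSpace :=
  (Submodule.isClosed_topologicalClosure _).completeSpace_coe

instance : MeasurableSpace SolenoidalSpace := borel _

instance : BorelSpace SolenoidalSpace := ⟨rfl⟩

/-! ### The Stokes operator, the regularisation and the Galerkin projections -/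

/-- The eigenspace `{f ∈ D(A) : A f = lam f}` of the Stokes operator `A = -𝐏Δ` on `H`. The equation
is tested against smooth divergence-free fields `φ`:
`⟨f, -Δφ⟩ = lam ⟨f, φ⟩`; here `p` and `q` are the `L²` classes of `φ` and of `ψ = -Δφ`.
It is nonzero exactly for the eigenvalues `lam = 4π²|k|²`, `k ∈ ℤ³`. -/
def stokesEigenspace (lam : ℝ) : Submodule ℝ SolenoidalSpace where
  carrier := {f | ∀ φ ψ : Torus3 → R3, IsSmoothSolenoidal φ →
    periodicLift ψ = -Laplacian.laplacian (periodicLift φ) →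
    ∀ p q : L2Field, p =ᵐ[torusMeasure] φ → q =ᵐ[torusMeasure] ψ →
      ⟪(f : L2Field), q⟫ = lam * ⟪(f : L2Field), p⟫}
  add_mem' := by
    intro f g hf hg φ ψ hφ hψ p q hp hq
    rw [Submodule.coe_add, inner_add_left, inner_add_left, hf φ ψ hφ hψ p q hp hq,
      hg φ ψ hφ hψ p q hp hq]
    ring
  zero_mem' := by
    intro φ ψ hφ hψ p q hp hq
    simp
  smul_mem' := by
    intro c f hf φ ψ hφ hψ p q hp hq
    rw [Submodule.coe_smul, real_inner_smul_left, real_inner_smul_left, hf φ ψ hφ hψ p q hp hq]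
    ring

theorem isClosed_stokesEigenspace (lam : ℝ) :
    IsClosed (stokesEigenspace lam : Set SolenoidalSpace) := by
  have h : (stokesEigenspace lam : Set SolenoidalSpace) =
      {f : SolenoidalSpace | ∀ φ ψ : Torus3 → R3, IsSmoothSolenoidal φ →
        periodicLift ψ = -Laplacian.laplacian (periodicLift φ) →
        ∀ p q : L2Field, p =ᵐ[torusMeasure] φ → q =ᵐ[torusMeasure] ψ →
          ⟪(f : L2Field), q⟫ = lam * ⟪(f : L2Field), p⟫} := rfl
  rw [h]
  simp only [Set.ofPred_forall]
  refine isClosed_iInter fun φ => isClosed_iInter fun ψ => isClosed_iInter fun _ =>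
    isClosed_iInter fun _ => isClosed_iInter fun p => isClosed_iInter fun q =>
    isClosed_iInter fun _ => isClosed_iInter fun _ => isClosed_eq ?_ ?_
  · exact continuous_subtype_val.inner continuous_const
  · exact continuous_const.mul (continuous_subtype_val.inner continuous_const)

instance (lam : ℝ) : CompleteSpace (stokesEigenspace lam) :=
  (isClosed_stokesEigenspace lam).completeSpace_coe

/-- Functional calculus of the Stokes operator: `F(A) f = ∑ F(lam) Π_lam f`, where `Π_lam` is the
orthogonal projection of `H` onto the eigenspace of `lam`. (`A` has a complete orthonormal system of
eigenvectors, so at most countably many summands are nonzero.) -/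
def stokesCalculus (F : ℝ → ℝ) (f : SolenoidalSpace) : SolenoidalSpace :=
  ∑' lam : ℝ, F lam • (stokesEigenspace lam).starProjection f

/-- The regularisation operator `Q_δ = (I + δ A^{2β})⁻¹` on `H`. -/
def regularisation (β δ : ℝ) : SolenoidalSpace → SolenoidalSpace :=
  stokesCalculus fun lam => (1 + δ * lam ^ (2 * β))⁻¹

/-- `f` is of the form `u cos(2π k·x)` or `u sin(2π k·x)` with `u ∈ ℝ³`, `u·k = 0`
(the real and the imaginary part of `u exp(2πi k·x)`). -/
def IsStokesMode (k : Fin 3 → ℤ) (f : SolenoidalSpace) : Prop :=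
  ∃ u : R3, ∑ i, u i * (k i : ℝ) = 0 ∧
    ((f : L2Field) =ᵐ[torusMeasure] (fun x => (UnitAddTorus.mFourier k x).re • u) ∨
      (f : L2Field) =ᵐ[torusMeasure] (fun x => (UnitAddTorus.mFourier k x).im • u))

/-- The (finite-dimensional, hence closed) span of the modes of frequency `|k| ≤ m`. -/
def galerkinSpace (m : ℕ) : Submodule ℝ SolenoidalSpace :=
  (Submodule.span ℝ {f | ∃ k : Fin 3 → ℤ, ∑ i, k i ^ 2 ≤ (m : ℤ) ^ 2 ∧
    IsStokesMode k f}).topologicalClosure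

instance (m : ℕ) : CompleteSpace (galerkinSpace m) :=
  (Submodule.isClosed_topologicalClosure _).completeSpace_coe

/-- The Galerkin projection `P_m`: the orthogonal projection of `H` onto the modes of frequency
at most `m`. -/
def galerkinProjection (m : ℕ) : SolenoidalSpace →L[ℝ] SolenoidalSpace :=
  (galerkinSpace m).starProjection

/-! ### Gaussian measures on a Hilbert space -/

section Gaussian

variable {E : Type*} [NormedAddCommGroup E] [InnerProductSpace ℝ E] [MeasurableSpace E]

/-- `μ` is a Gaussian distribution with mean `u` and covariance operator `Q`: under `μ`, every
`⟨h, ·⟩` has the normal law with mean `⟨h, u⟩` and variance `⟨h, Q h⟩`. -/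
def IsGaussianLaw (μ : Measure E) (u : E) (Q : E → E) : Prop :=
  ∀ h : E, μ.map (fun v => ⟪h, v⟫) = gaussianReal ⟪h, u⟫ ⟪h, Q h⟫.toNNReal

/-- A Gaussian distribution is determined by its mean and its covariance. -/
theorem IsGaussianLaw.unique [BorelSpace E] [SecondCountableTopology E] [CompleteSpace E]
    {μ ν : Measure E} {u : E} {Q : E → E} (hμ : IsGaussianLaw μ u Q) (hν : IsGaussianLaw ν u Q) :
    μ = ν := by
  have hm : ∀ h : E, Measurable fun v : E => ⟪h, v⟫ := fun h =>
    (continuous_const.inner continuous_id).measurable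
  have prob : ∀ {ρ : Measure E}, IsGaussianLaw ρ u Q → IsProbabilityMeasure ρ := by
    intro ρ hρ
    have h0 : IsProbabilityMeasure (ρ.map fun v : E => ⟪(0 : E), v⟫) := by
      rw [hρ 0]; infer_instance
    exact (Measure.isProbabilityMeasure_map_iff (hm 0).aemeasurable).1 h0
  have := prob hμ
  have := prob hν
  refine Measure.ext_of_charFun (funext fun h => ?_)
  have key : ∀ ρ : Measure E, charFun ρ h = charFun (ρ.map fun v => ⟪h, v⟫) 1 := by
    intro ρ
    rw [charFun_apply_real, charFun_apply, integral_map (hm h).aemeasurable (by fun_prop)]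
    simp [real_inner_comm]
  rw [key, key, hμ h, hν h]

open Classical in
/-- `𝒢(u, Q)`: the Gaussian distribution with mean `u` and covariance `Q` (and the zero measure if
there is none). -/
def gaussianMeasure (u : E) (Q : E → E) : Measure E :=
  if h : ∃ μ : Measure E, IsGaussianLaw μ u Q then h.choose else 0

end Gaussian

/-! ### The assumption on the initial data -/

section Assumption

variable {E : Type*} [NormedAddCommGroup E] [InnerProductSpace ℝ E] [MeasurableSpace E]

/-- `Z(η) = limsup_{ε → 0} ε log 𝔼[exp(η ‖U^ε‖² / ε)]`, where `U^ε` has the law `μ ε`, as an extended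
real number. -/
def expMomentLimit (μ : ℝ → Measure E) (η : ℝ) : EReal :=
  limsup (fun ε : ℝ => (ε : EReal) *
    ENNReal.log (∫⁻ v, ENNReal.ofReal (Real.exp (η * ‖v‖ ^ 2 / ε)) ∂(μ ε))) (𝓝[>] 0)

/-- The laws `μ ε`, `ε > 0`, of random initial data satisfy a large deviation upper bound in the
weak topology and a lower bound in the norm topology as `ε → 0`, with speed `1 / ε` and the rate
function `I₀`, which is norm-continuous and has exactly one zero `u⋆`; they have
exponential Gaussian moments with `limsup_{η → 0} Z(η) / η ≤ ‖u⋆‖²`. -/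
structure InitialDataAssumption (μ : ℝ → Measure E) (I₀ : E → ℝ≥0∞) : Prop where
  isProbabilityMeasure : ∀ ε : ℝ, 0 < ε → IsProbabilityMeasure (μ ε)
  upper_bound : ∀ A : Set E, IsClosed (toWeakSpace ℝ E '' A) →
    limsup (fun ε : ℝ => (ε : EReal) * ENNReal.log (μ ε A)) (𝓝[>] 0)
      ≤ -⨅ u ∈ A, (I₀ u : EReal)
  lower_bound : ∀ U : Set E, IsOpen U →
    -⨅ u ∈ U, (I₀ u : EReal)
      ≤ liminf (fun ε : ℝ => (ε : EReal) * ENNReal.log (μ ε U)) (𝓝[>] 0)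
  continuous_rate : Continuous I₀
  exists_unique_zero : ∃ ustar : E, (∀ v, I₀ v = 0 ↔ v = ustar) ∧
    limsup (fun η : ℝ => expMomentLimit μ η / (η : EReal)) (𝓝[≠] 0) ≤ ((‖ustar‖ ^ 2 : ℝ) : EReal)
  finite_expMoment : ∀ᶠ η in 𝓝[>] (0 : ℝ), expMomentLimit μ η ≠ ⊤ ∧ expMomentLimit μ η ≠ ⊥

end Assumption

end

noncomputable section

open scoped NNReal

/-! ### Moments of one-dimensional Gaussian laws -/

/-! All the covariances are diagonal in one Hilbert basis `modeBasis` of `H`, made of fields `u (cos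
+ sin)(2πk·x)` with `u ⟂ k`. Taking cos + sin lets `k` run through all of `ℤ³`: `k` and `-k` give
orthogonal modes, so no half-lattice has to be chosen and the frequency zero is not special. In this
basis the Gaussian measure is the law of a mean plus `∑ zᵢ bᵢ` with independent centred normal `zᵢ`
of variance `ε qᵢ / 2`, and the claim becomes a statement about such series,
`initialDataAssumption_of_diagonal`. It asks for `0 ≤ qᵢ ≤ 1`, `qᵢ → 1` for each `i`, convergent
means, and summable `q` with `ε ∑ qᵢ → 0`.

Three exponential estimates suffice, by `initialDataAssumption_of_bounds`. (a) A small ball around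
`v` has probability at least about `exp(-‖v - u₀‖² / ε)`: finitely many coordinates are put in a
box, and the others are small by Markov's inequality because the trace is small. (b) The half-space
`⟪h, v - u₀⟫ ≥ c`, with `h` a unit vector, has probability at most about `exp(-c² / ε)`: this is a
one-dimensional Chernoff bound, the variance being at most `ε / 2`. (c) The exponential moments of
`η ‖v‖² / ε` factor over the coordinates, and the fluctuations contribute only a multiple of the
trace.

Balls give the lower bound. Moments give exponential tightness in norm; a bounded part of a weakly
closed set is relatively weakly compact, hence covered by finitely many half-spaces away from `u₀`,
which gives the upper bound.

The trace condition holds because both symbols are at most `1_{k=0} + a |k|⁻⁵`, with `a =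
δ^(-5/(4β))` or `a = m⁵`, and `|k|⁻⁵` is summable over `ℤ³`. -/

theorem lintegral_sq_gaussianReal (v : ℝ≥0) :
    ∫⁻ x, ENNReal.ofReal (x ^ 2) ∂gaussianReal 0 v = v := by
  have hvar := variance_fun_id_gaussianReal (μ := 0) (v := v)
  rw [variance_eq_integral measurable_id'.aemeasurable] at hvar
  simp only [integral_id_gaussianReal, sub_zero] at hvar
  have hint : Integrable (fun x : ℝ => x ^ 2) (gaussianReal 0 v) :=
    (memLp_id_gaussianReal' 2 (by simp)).integrable_sq
  rw [← ofReal_integral_eq_lintegral_ofReal hint (ae_of_all _ fun x => sq_nonneg x), hvar,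
    ENNReal.ofReal_coe_nnreal]

/-- For `v ≠ 0` the integral equals `(1 - y)^(-1/2)` with `y = 2sv ≤ 1/2`, and `(1 - y) exp(2y) ≥ (1
- y)(1 + 2y) ≥ 1` there. A bound exponential in `v` turns products over coordinates into traces. -/
theorem lintegral_exp_sq_gaussianReal_le {s : ℝ} {v : ℝ≥0} (hs : 0 ≤ s) (hsv : s * v ≤ 1 / 4) :
    ∫⁻ x, ENNReal.ofReal (Real.exp (s * x ^ 2)) ∂gaussianReal 0 v
      ≤ ENNReal.ofReal (Real.exp (2 * s * v)) := by
  rcases eq_or_ne v 0 with rfl | hv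
  · simp
  have hv' : (0 : ℝ) < v := by positivity
  have hb : 0 < 1 / (2 * (v : ℝ)) - s := by
    rw [sub_pos, lt_div_iff₀ (by positivity)]; nlinarith
  rw [gaussianReal_of_var_ne_zero _ hv,
    lintegral_withDensity_eq_lintegral_mul _ (measurable_gaussianPDF 0 v) (by fun_prop)]
  have hpt : ∀ x : ℝ, (gaussianPDF 0 v * fun x => ENNReal.ofReal (Real.exp (s * x ^ 2))) x
      = ENNReal.ofReal ((√(2 * Real.pi * v))⁻¹ * Real.exp (-(1 / (2 * (v : ℝ)) - s) * x ^ 2)) := by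
    intro x
    simp only [Pi.mul_apply, gaussianPDF_def, gaussianPDFReal_def]
    rw [← ENNReal.ofReal_mul (by positivity), mul_assoc, ← Real.exp_add]
    congr 3
    field_simp
    ring
  simp_rw [hpt]
  rw [← ofReal_integral_eq_lintegral_ofReal ((integrable_exp_neg_mul_sq hb).const_mul _)
    (ae_of_all _ fun x => by positivity), integral_const_mul, integral_gaussian]
  refine ENNReal.ofReal_le_ofReal ?_
  set y : ℝ := 2 * s * v with hy
  have hy0 : 0 ≤ y := by positivity
  have hy1 : y ≤ 1 / 2 := by rw [hy]; linarith
  have h1 : Real.pi / (1 / (2 * (v : ℝ)) - s) = (2 * Real.pi * v) * (1 - y)⁻¹ := by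
    have : (1 - y) = 2 * v * (1 / (2 * (v : ℝ)) - s) := by rw [hy]; field_simp
    rw [this]; field_simp
  rw [h1, Real.sqrt_mul (x := 2 * Real.pi * v) (by positivity), ← mul_assoc,
    inv_mul_cancel₀ (by positivity), one_mul]
  refine Real.sqrt_le_iff.2 ⟨by positivity, ?_⟩
  rw [← Real.exp_nat_mul, inv_le_iff_one_le_mul₀ (by linarith)]
  have := Real.add_one_le_exp (((2 : ℕ) : ℝ) * y)
  push_cast at this ⊢
  nlinarith

/-- An interval of radius `r` around `h` has probability at least `exp(-(|h| + r)² / (2v))` for a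
centred normal law of small variance `v`. -/
theorem le_gaussianReal_ball {v : ℝ≥0} (hv : v ≠ 0) {h r : ℝ}
    (hvr : √(2 * Real.pi * v) ≤ 2 * r) :
    ENNReal.ofReal (Real.exp (-((|h| + r) ^ 2 / (2 * v)))) ≤
      gaussianReal 0 v (Metric.ball h r) := by
  have hv' : (0 : ℝ) < v := by positivity
  rw [gaussianReal_apply _ hv]
  have hlow : ∀ x ∈ Metric.ball h r,
      ENNReal.ofReal ((√(2 * Real.pi * v))⁻¹ * Real.exp (-((|h| + r) ^ 2 / (2 * v))))
        ≤ gaussianPDF 0 v x := by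
    intro x hx
    rw [gaussianPDF_def, gaussianPDFReal_def, neg_div']
    refine ENNReal.ofReal_le_ofReal ?_
    have hx' : |x| ≤ |h| + r := by
      rw [Metric.mem_ball, Real.dist_eq] at hx
      have := abs_sub_abs_le_abs_sub x h
      linarith
    have hsq : x ^ 2 ≤ (|h| + r) ^ 2 := by
      rw [← sq_abs x]; exact pow_le_pow_left₀ (abs_nonneg _) hx' 2
    simp only [sub_zero]
    gcongr
  refine le_trans ?_ (setLIntegral_mono' measurableSet_ball hlow)
  rw [setLIntegral_const, Real.volume_ball, ← ENNReal.ofReal_mul (by positivity)]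
  refine ENNReal.ofReal_le_ofReal ?_
  -- The length of the interval absorbs the normalising factor of the density.
  have : 1 ≤ (√(2 * Real.pi * v))⁻¹ * (2 * r) := by
    rw [inv_mul_eq_div, one_le_div (by positivity)]; exact hvr
  calc Real.exp (-((|h| + r) ^ 2 / (2 * v)))
      = 1 * Real.exp (-((|h| + r) ^ 2 / (2 * v))) := (one_mul _).symm
    _ ≤ ((√(2 * Real.pi * v))⁻¹ * (2 * r)) * Real.exp (-((|h| + r) ^ 2 / (2 * v))) := by gcongr
    _ = _ := by ring

/-- Chernoff's bound at the parameter `(c - a) / w`, optimal for variance `w`. Working with an upper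
bound `w > 0` also covers the degenerate law `v = 0`. -/
theorem gaussianReal_Ici_le {a c w : ℝ} {v : ℝ≥0} (hw : 0 < w) (hvw : (v : ℝ) ≤ w) (hac : a ≤ c) :
    gaussianReal a v (Set.Ici c) ≤ ENNReal.ofReal (Real.exp (-((c - a) ^ 2 / (2 * w)))) := by
  have ht : 0 ≤ (c - a) / w := div_nonneg (by linarith) hw.le
  have h := measure_ge_le_exp_mul_mgf (μ := gaussianReal a v) (X := id) c ht
    (integrable_exp_mul_gaussianReal _)
  rw [mgf_id_gaussianReal, ← Real.exp_add] at h
  rw [← ENNReal.ofReal_toReal (measure_ne_top (gaussianReal a v) (Set.Ici c))]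
  refine ENNReal.ofReal_le_ofReal (le_trans h (Real.exp_le_exp.2 ?_))
  have h1 : (v : ℝ) * ((c - a) / w) ^ 2 / 2 ≤ w * ((c - a) / w) ^ 2 / 2 := by gcongr
  have h2 : -((c - a) / w) * c + (a * ((c - a) / w) + w * ((c - a) / w) ^ 2 / 2)
      = -((c - a) ^ 2 / (2 * w)) := by
    field_simp; ring
  linarith

/-! ### Sequences of independent centred normal variables -/

section Coordinates

variable {ι : Type*}

/-- The law of a family of independent centred normal variables of variances `σ i`. -/
def gaussianCoordinates (σ : ι → ℝ≥0) : Measure (ι → ℝ) :=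
  Measure.infinitePi fun i => gaussianReal 0 (σ i)

instance (σ : ι → ℝ≥0) : IsProbabilityMeasure (gaussianCoordinates σ) := by
  unfold gaussianCoordinates; infer_instance

theorem map_eval_gaussianCoordinates (σ : ι → ℝ≥0) (i : ι) :
    (gaussianCoordinates σ).map (fun z => z i) = gaussianReal 0 (σ i) :=
  Measure.infinitePi_map_eval _ i

theorem lintegral_eval_gaussianCoordinates (σ : ι → ℝ≥0) (i : ι) {f : ℝ → ℝ≥0∞}
    (hf : Measurable f) :
    ∫⁻ z, f (z i) ∂gaussianCoordinates σ = ∫⁻ x, f x ∂gaussianReal 0 (σ i) := by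
  rw [← map_eval_gaussianCoordinates σ i, lintegral_map hf (measurable_pi_apply i)]

theorem lintegral_prod_gaussianCoordinates (σ : ι → ℝ≥0) (s : Finset ι) {f : ι → ℝ → ℝ≥0∞}
    (hf : ∀ i, Measurable (f i)) :
    ∫⁻ z, ∏ i ∈ s, f i (z i) ∂gaussianCoordinates σ
      = ∏ i ∈ s, ∫⁻ x, f i x ∂gaussianReal 0 (σ i) := by
  have h := iIndepFun_infinitePi (P := fun i => gaussianReal 0 (σ i)) hf
  rw [gaussianCoordinates, lintegral_prod_eq_prod_lintegral_of_indepFun s _ h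
    fun i => (hf i).comp (measurable_pi_apply i)]
  exact Finset.prod_congr rfl fun i _ => lintegral_eval_gaussianCoordinates σ i (hf i)

theorem lintegral_tsum_sq_gaussianCoordinates [Countable ι] (σ : ι → ℝ≥0) :
    ∫⁻ z, ∑' i, ENNReal.ofReal (z i ^ 2) ∂gaussianCoordinates σ = ∑' i, (σ i : ℝ≥0∞) := by
  rw [lintegral_tsum fun i => Measurable.aemeasurable (by fun_prop)]
  refine tsum_congr fun i => ?_
  rw [lintegral_eval_gaussianCoordinates σ i (f := fun x => ENNReal.ofReal (x ^ 2)) (by fun_prop),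
    lintegral_sq_gaussianReal]

theorem ae_summable_sq_gaussianCoordinates [Countable ι] {σ : ι → ℝ≥0} (hσ : Summable σ) :
    ∀ᵐ z ∂gaussianCoordinates σ, Summable fun i => z i ^ 2 := by
  have h : ∫⁻ z, ∑' i, ENNReal.ofReal (z i ^ 2) ∂gaussianCoordinates σ ≠ ⊤ := by
    rw [lintegral_tsum_sq_gaussianCoordinates]
    exact ENNReal.tsum_coe_ne_top_iff_summable.2 hσ
  have hm : Measurable fun z : ι → ℝ => ∑' i, ENNReal.ofReal (z i ^ 2) := by fun_prop
  filter_upwards [ae_lt_top hm h] with z hz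
  have := ENNReal.summable_toReal hz.ne
  simpa [ENNReal.toReal_ofReal, sq_nonneg] using this

/-- Independence factors the integral for finitely many coordinates; Fatou's lemma passes to the
whole series. -/
theorem lintegral_exp_tsum_sq_gaussianCoordinates_le [Countable ι] {σ : ι → ℝ≥0} (hσ : Summable σ)
    {s : ℝ} (hs : 0 ≤ s) (hsσ : ∀ i, s * σ i ≤ 1 / 4) :
    ∫⁻ z, ENNReal.ofReal (Real.exp (s * ∑' i, z i ^ 2)) ∂gaussianCoordinates σ
      ≤ ENNReal.ofReal (Real.exp (2 * s * ∑' i, (σ i : ℝ))) := by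
  have hσ' : Summable fun i => (σ i : ℝ) := NNReal.summable_coe.2 hσ
  have hfin : ∀ F : Finset ι, ∫⁻ z, ∏ i ∈ F, ENNReal.ofReal (Real.exp (s * z i ^ 2))
      ∂gaussianCoordinates σ ≤ ENNReal.ofReal (Real.exp (2 * s * ∑' i, (σ i : ℝ))) := by
    intro F
    rw [lintegral_prod_gaussianCoordinates σ F
      (f := fun _ x => ENNReal.ofReal (Real.exp (s * x ^ 2))) fun i => by fun_prop]
    refine (Finset.prod_le_prod' fun i _ => lintegral_exp_sq_gaussianReal_le hs (hsσ i)).trans ?_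
    rw [← ENNReal.ofReal_prod_of_nonneg fun i _ => (Real.exp_pos _).le, ← Real.exp_sum,
      ← Finset.mul_sum]
    gcongr
    exact hσ'.sum_le_tsum F fun i _ => NNReal.coe_nonneg _
  have hlim : ∫⁻ z, ENNReal.ofReal (Real.exp (s * ∑' i, z i ^ 2)) ∂gaussianCoordinates σ
      = ∫⁻ z, liminf (fun F : Finset ι => ∏ i ∈ F, ENNReal.ofReal (Real.exp (s * z i ^ 2))) atTop
        ∂gaussianCoordinates σ := by
    refine lintegral_congr_ae ?_
    filter_upwards [ae_summable_sq_gaussianCoordinates hσ] with z hz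
    refine (Tendsto.liminf_eq ?_).symm
    have h1 : Tendsto (fun F : Finset ι => Real.exp (s * ∑ i ∈ F, z i ^ 2)) atTop
        (𝓝 (Real.exp (s * ∑' i, z i ^ 2))) :=
      (Real.continuous_exp.tendsto _).comp (hz.hasSum.const_mul s)
    refine (ENNReal.tendsto_ofReal h1).congr fun F => ?_
    rw [← ENNReal.ofReal_prod_of_nonneg fun i _ => (Real.exp_pos _).le, ← Real.exp_sum,
      ← Finset.mul_sum]
  rw [hlim]
  refine (lintegral_liminf_le fun F => by fun_prop).trans ?_
  refine Filter.liminf_le_of_le (by isBoundedDefault) fun b hb => ?_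
  obtain ⟨F, hF⟩ := hb.exists
  exact hF.trans (hfin F)

/-- A box in finitely many coordinates together with a bound on the remaining coordinates has at
least half of the probability of the box. -/
theorem half_prod_le_gaussianCoordinates [Countable ι] {σ : ι → ℝ≥0} (F : Finset ι)
    {B : ι → Set ℝ} (hB : ∀ i, MeasurableSet (B i)) {t : ℝ} (ht : 0 < t)
    (hσt : ∑' i, (σ i : ℝ≥0∞) ≤ ENNReal.ofReal t / 2) :
    (∏ i ∈ F, gaussianReal 0 (σ i) (B i)) / 2 ≤
      gaussianCoordinates σ {z | (∀ i ∈ F, z i ∈ B i) ∧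
        ∑' i : {i // i ∉ F}, ENNReal.ofReal (z i ^ 2) < ENNReal.ofReal t} := by
  classical
  set P := gaussianCoordinates σ
  set A : Set (ι → ℝ) := {z | ∀ i ∈ F, z i ∈ B i} with hA
  have hAm : MeasurableSet A := by
    have : A = ⋂ i ∈ F, (fun z : ι → ℝ => z i) ⁻¹' B i := by ext z; simp [hA]
    rw [this]
    exact Finset.measurableSet_biInter F fun i _ => measurable_pi_apply i (hB i)
  set p : ℝ≥0∞ := ∏ i ∈ F, gaussianReal 0 (σ i) (B i)
  have hind : ∀ z : ι → ℝ, A.indicator (1 : (ι → ℝ) → ℝ≥0∞) z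
      = ∏ i ∈ F, (B i).indicator (1 : ℝ → ℝ≥0∞) (z i) := by
    intro z
    by_cases h : z ∈ A
    · rw [Set.indicator_of_mem h]
      exact (Finset.prod_eq_one fun i hi => Set.indicator_of_mem (h i hi) _).symm
    · rw [Set.indicator_of_notMem h]
      obtain ⟨i, hi, hiB⟩ : ∃ i ∈ F, z i ∉ B i := by simpa [hA] using h
      exact (Finset.prod_eq_zero hi (Set.indicator_of_notMem hiB _)).symm
  have hPA : P A = p := by
    rw [← lintegral_indicator_one hAm]
    simp_rw [hind]
    rw [lintegral_prod_gaussianCoordinates σ F (f := fun i => (B i).indicator 1)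
      fun i => measurable_one.indicator (hB i)]
    exact Finset.prod_congr rfl fun i _ => lintegral_indicator_one (hB i)
  have hp1 : p ≠ ⊤ := hPA ▸ measure_ne_top P A
  set T : (ι → ℝ) → ℝ≥0∞ := fun z => ∑' i : {i // i ∉ F}, ENNReal.ofReal (z i ^ 2) with hT
  have hTm : Measurable T := by fun_prop
  -- A coordinate outside `F` is independent of the box, so its second moment restricted to the box
  -- factors.
  have hcoord : ∀ j : {j // j ∉ F}, ∫⁻ z in A, ENNReal.ofReal (z j ^ 2) ∂P = p * σ j := by
    intro j
    set f : ι → ℝ → ℝ≥0∞ := fun i => if i = j then fun x => ENNReal.ofReal (x ^ 2)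
      else (B i).indicator 1 with hf
    have hfm : ∀ i, Measurable (f i) := by
      intro i
      simp only [hf]
      split_ifs
      · fun_prop
      · exact measurable_one.indicator (hB i)
    have hne : ∀ i ∈ F, i ≠ (j : ι) := fun i hi h => j.2 (h ▸ hi)
    have hprod : ∀ z : ι → ℝ, A.indicator (fun z => ENNReal.ofReal (z j ^ 2)) z
        = ∏ i ∈ insert (j : ι) F, f i (z i) := by
      intro z
      rw [Finset.prod_insert j.2, ← one_mul (A.indicator _ z)]
      have h1 : ∏ i ∈ F, f i (z i) = A.indicator 1 z := by
        rw [hind]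
        exact Finset.prod_congr rfl fun i hi => by simp [hf, hne i hi]
      rw [h1, one_mul]
      by_cases h : z ∈ A <;> simp [h, hf]
    rw [← lintegral_indicator hAm]
    simp_rw [hprod]
    rw [lintegral_prod_gaussianCoordinates σ _ hfm, Finset.prod_insert j.2, mul_comm]
    congr 1
    · refine Finset.prod_congr rfl fun i hi => ?_
      simp only [hf, if_neg (hne i hi)]
      exact lintegral_indicator_one (hB i)
    · simp only [hf, if_pos]
      exact lintegral_sq_gaussianReal _
  have hTint : ∫⁻ z in A, T z ∂P ≤ p * (ENNReal.ofReal t / 2) := by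
    rw [hT, lintegral_tsum fun i => Measurable.aemeasurable (by fun_prop)]
    simp_rw [hcoord]
    rw [ENNReal.tsum_mul_left]
    gcongr
    refine le_trans ?_ hσt
    exact ENNReal.tsum_comp_le_tsum_of_injective Subtype.val_injective fun i => (σ i : ℝ≥0∞)
  have ht0 : ENNReal.ofReal t ≠ 0 := by simpa using ht
  -- Markov's inequality on the box: the mean of the tail there is at most `p t / 2`.
  have hbad : P (A ∩ {z | ENNReal.ofReal t ≤ T z}) ≤ p / 2 := by
    have h := meas_ge_le_lintegral_div (μ := P.restrict A) hTm.aemeasurable ht0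
      ENNReal.ofReal_ne_top
    rw [Measure.restrict_apply (measurableSet_le measurable_const hTm), Set.inter_comm] at h
    refine h.trans ((ENNReal.div_le_div_right hTint _).trans (le_of_eq ?_))
    rw [ENNReal.div_eq_inv_mul, ENNReal.div_eq_inv_mul, ENNReal.div_eq_inv_mul]
    calc (ENNReal.ofReal t)⁻¹ * (p * (2⁻¹ * ENNReal.ofReal t))
        = ((ENNReal.ofReal t)⁻¹ * ENNReal.ofReal t) * (2⁻¹ * p) := by ring
      _ = 2⁻¹ * p := by rw [ENNReal.inv_mul_cancel ht0 ENNReal.ofReal_ne_top, one_mul]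
  have hsplit : P A ≤ P (A ∩ {z | ENNReal.ofReal t ≤ T z}) + P {z | z ∈ A ∧ T z < ENNReal.ofReal t} := by
    refine (measure_mono ?_).trans (measure_union_le _ _)
    intro z hz
    rcases le_or_gt (ENNReal.ofReal t) (T z) with h | h
    · exact Or.inl ⟨hz, h⟩
    · exact Or.inr ⟨hz, h⟩
  rw [hPA] at hsplit
  have h2 : p / 2 + p / 2 ≤ p / 2 + P {z | z ∈ A ∧ T z < ENNReal.ofReal t} := by
    rw [ENNReal.add_halves]
    exact hsplit.trans (by gcongr)
  exact (ENNReal.add_le_add_iff_left (ENNReal.div_ne_top hp1 (by simp))).1 h2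

theorem charFun_finset_sum_gaussianCoordinates (σ : ι → ℝ≥0) (c : ι → ℝ) (F : Finset ι) (t : ℝ) :
    ∫ z, Complex.exp (t * (∑ i ∈ F, c i * z i : ℝ) * Complex.I) ∂gaussianCoordinates σ
      = Complex.exp (((-(t ^ 2 / 2) * ∑ i ∈ F, σ i * c i ^ 2 : ℝ)) : ℂ) := by
  have hind : iIndepFun (fun i (z : ι → ℝ) => c i * z i) (gaussianCoordinates σ) :=
    iIndepFun_infinitePi (P := fun i => gaussianReal 0 (σ i)) (X := fun i x => c i * x)
      fun i => by fun_prop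
  have hm : ∀ i, AEMeasurable (fun z : ι → ℝ => c i * z i) (gaussianCoordinates σ) := fun i =>
    Measurable.aemeasurable (by fun_prop)
  have h := iIndepFun.charFun_map_fun_finsetSum_eq_prod (s := F) (fun i _ => hm i)
    (hind.precomp (g := fun i : F => (i : ι)) Subtype.val_injective)
  have h' := congrFun h t
  rw [charFun_apply_real, integral_map (Finset.aemeasurable_fun_sum F fun i _ => hm i)
    (by fun_prop)] at h'
  rw [h', Finset.prod_apply, Finset.mul_sum, Complex.ofReal_sum, Complex.exp_sum]
  refine Finset.prod_congr rfl fun i _ => ?_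
  have hlaw : HasLaw (fun z : ι → ℝ => z i) (gaussianReal 0 (σ i)) (gaussianCoordinates σ) :=
    ⟨(measurable_pi_apply i).aemeasurable, map_eval_gaussianCoordinates σ i⟩
  rw [(gaussianReal_const_mul hlaw (c i)).map_eq, charFun_gaussianReal]
  congr 1
  push_cast
  simp
  ring

end Coordinates

/-! ### Gaussian series in a Hilbert space -/

section Series

variable {ι E : Type*} [NormedAddCommGroup E] [InnerProductSpace ℝ E]

/-- Needed for `IsGaussianLaw.unique`, which identifies measures by their characteristic functions.
-/
theorem HilbertBasis.secondCountableTopology [Countable ι] (b : HilbertBasis ι ℝ E) :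
    SecondCountableTopology E := by
  have h : TopologicalSpace.IsSeparable (Set.univ : Set E) := by
    have h1 : TopologicalSpace.IsSeparable (Submodule.span ℝ (Set.range b) : Set E) :=
      (Set.countable_range b).isSeparable.span (R := ℝ)
    have h2 := h1.closure
    rwa [← Submodule.topologicalClosure_coe, b.dense_span, Submodule.top_coe] at h2
  have := TopologicalSpace.isSeparable_univ_iff.1 h
  exact UniformSpace.secondCountable_of_separable E

theorem HilbertBasis.hasSum_sq_inner [CompleteSpace E] (b : HilbertBasis ι ℝ E) (x : E) :
    HasSum (fun i => ⟪b i, x⟫ ^ 2) (‖x‖ ^ 2) := by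
  have h := b.hasSum_inner_mul_inner x x
  rw [real_inner_self_eq_norm_sq] at h
  refine h.congr_fun fun i => ?_
  rw [real_inner_comm x (b i), sq]

/-- The series `∑ᵢ zᵢ bᵢ` in a Hilbert basis `b`. -/
def basisSeries (b : HilbertBasis ι ℝ E) (z : ι → ℝ) : E := ∑' i, z i • b i

variable [CompleteSpace E]

theorem hasSum_basisSeries (b : HilbertBasis ι ℝ E) {z : ι → ℝ} (hz : Summable fun i => z i ^ 2) :
    HasSum (fun i => z i • b i) (basisSeries b z) := by
  have h := (b.orthonormal.orthogonalFamily.summable_iff_norm_sq_summable z).2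
    (by simpa [Real.norm_eq_abs, sq_abs] using hz)
  exact Summable.hasSum (by simpa using h)

theorem inner_basisSeries (b : HilbertBasis ι ℝ E) {z : ι → ℝ} (hz : Summable fun i => z i ^ 2)
    (i : ι) : ⟪b i, basisSeries b z⟫ = z i := by
  classical
  have h := (hasSum_basisSeries b hz).mapL (innerSL ℝ (b i))
  refine h.unique ?_
  have h2 := hasSum_ite_eq i (z i)
  refine h2.congr_fun fun j => ?_
  rw [innerSL_apply_apply, real_inner_smul_right, orthonormal_iff_ite.1 b.orthonormal i j]
  by_cases hij : j = i
  · simp [hij]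
  · simp [hij, Ne.symm hij]

theorem hasSum_norm_basisSeries_sub_sq (b : HilbertBasis ι ℝ E) {z : ι → ℝ}
    (hz : Summable fun i => z i ^ 2) (x : E) :
    HasSum (fun i => (z i - ⟪b i, x⟫) ^ 2) (‖basisSeries b z - x‖ ^ 2) := by
  refine (b.hasSum_sq_inner (basisSeries b z - x)).congr_fun fun i => ?_
  rw [inner_sub_right, inner_basisSeries b hz]

variable [Countable ι] [MeasurableSpace E] [BorelSpace E]

theorem aemeasurable_basisSeries (b : HilbertBasis ι ℝ E) {σ : ι → ℝ≥0} (hσ : Summable σ) :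
    AEMeasurable (basisSeries b) (gaussianCoordinates σ) := by
  refine aemeasurable_of_tendsto_metrizable_ae (atTop : Filter (Finset ι))
    (f := fun F z => ∑ i ∈ F, z i • b i) (fun F => ?_) ?_
  · have : Continuous fun z : ι → ℝ => ∑ i ∈ F, z i • b i := by fun_prop
    exact this.measurable.aemeasurable
  · filter_upwards [ae_summable_sq_gaussianCoordinates hσ] with z hz
    exact hasSum_basisSeries b hz

/-- The law of `u + ∑ᵢ zᵢ bᵢ` with independent `zᵢ ∼ 𝒩(0, σᵢ)`. -/
def gaussianSeriesLaw (b : HilbertBasis ι ℝ E) (u : E) (σ : ι → ℝ≥0) : Measure E :=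
  (gaussianCoordinates σ).map fun z => u + basisSeries b z

theorem aemeasurable_add_basisSeries (b : HilbertBasis ι ℝ E) (u : E) {σ : ι → ℝ≥0}
    (hσ : Summable σ) : AEMeasurable (fun z => u + basisSeries b z) (gaussianCoordinates σ) :=
  (continuous_const.add continuous_id).measurable.comp_aemeasurable (aemeasurable_basisSeries b hσ)

theorem isProbabilityMeasure_gaussianSeriesLaw (b : HilbertBasis ι ℝ E) (u : E) {σ : ι → ℝ≥0}
    (hσ : Summable σ) : IsProbabilityMeasure (gaussianSeriesLaw b u σ) :=
  Measure.isProbabilityMeasure_map (aemeasurable_add_basisSeries b u hσ)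

/-- Both sides are limits of the characteristic functions of the finite partial sums: one by
dominated convergence, the integrands having modulus one, the other because Parseval's identity
gives `⟪h, Q h⟫ = ∑ σᵢ ⟪h, bᵢ⟫²`. -/
theorem isGaussianLaw_gaussianSeriesLaw (b : HilbertBasis ι ℝ E) (u : E) {σ : ι → ℝ≥0}
    (hσ : Summable σ) {Q : E → E} (hQ : ∀ i v, ⟪b i, Q v⟫ = σ i * ⟪b i, v⟫) :
    IsGaussianLaw (gaussianSeriesLaw b u σ) u Q := by
  intro h
  have hmi : Measurable fun v : E => ⟪h, v⟫ := (continuous_const.inner continuous_id).measurable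
  have hvar : HasSum (fun i => (σ i : ℝ) * ⟪h, b i⟫ ^ 2) ⟪h, Q h⟫ := by
    refine (b.hasSum_inner_mul_inner h (Q h)).congr_fun fun i => ?_
    rw [hQ, real_inner_comm h (b i)]
    ring
  have hvar0 : 0 ≤ ⟪h, Q h⟫ := hvar.nonneg fun i => by positivity
  rw [gaussianSeriesLaw, AEMeasurable.map_map_of_aemeasurable hmi.aemeasurable
    (aemeasurable_add_basisSeries b u hσ)]
  have hm := hmi.comp_aemeasurable (aemeasurable_add_basisSeries b u hσ)
  have : IsProbabilityMeasure ((gaussianCoordinates σ).map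
      ((fun v : E => ⟪h, v⟫) ∘ fun z => u + basisSeries b z)) :=
    Measure.isProbabilityMeasure_map hm
  refine Measure.ext_of_charFun (funext fun t => ?_)
  rw [charFun_gaussianReal, charFun_apply_real, integral_map hm (by fun_prop)]
  simp only [Function.comp_apply]
  have hlim : Tendsto (fun F : Finset ι => ∫ z, Complex.exp (t * (⟪h, u⟫ : ℝ) * Complex.I) *
      Complex.exp (t * (∑ i ∈ F, ⟪h, b i⟫ * z i : ℝ) * Complex.I) ∂gaussianCoordinates σ) atTop
      (𝓝 (∫ z, Complex.exp (t * (⟪h, u + basisSeries b z⟫ : ℝ) * Complex.I)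
        ∂gaussianCoordinates σ)) := by
    refine tendsto_integral_filter_of_dominated_convergence (fun _ => 1) ?_ ?_ (by simp) ?_
    · refine Eventually.of_forall fun F => Measurable.aestronglyMeasurable ?_
      fun_prop
    · refine Eventually.of_forall fun F => ae_of_all _ fun z => le_of_eq ?_
      rw [norm_mul, ← Complex.ofReal_mul, ← Complex.ofReal_mul, Complex.norm_exp_ofReal_mul_I,
        Complex.norm_exp_ofReal_mul_I, one_mul]
    · filter_upwards [ae_summable_sq_gaussianCoordinates hσ] with z hz
      have h1 : HasSum (fun i => ⟪h, b i⟫ * z i) ⟪h, basisSeries b z⟫ := by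
        refine ((hasSum_basisSeries b hz).mapL (innerSL ℝ h)).congr_fun fun i => ?_
        rw [innerSL_apply_apply, real_inner_smul_right, mul_comm]
      have h2 : Continuous fun x : ℝ => Complex.exp (t * (⟪h, u⟫ : ℝ) * Complex.I) *
        Complex.exp (t * (x : ℝ) * Complex.I) := by fun_prop
      have h3 := (h2.tendsto ⟪h, basisSeries b z⟫).comp h1
      convert! h3 using 2
      rw [← Complex.exp_add, inner_add_right]
      congr 1
      push_cast
      ring
  refine tendsto_nhds_unique hlim ?_
  simp_rw [integral_const_mul, charFun_finset_sum_gaussianCoordinates]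
  have h2 : Continuous fun x : ℝ => Complex.exp (t * (⟪h, u⟫ : ℝ) * Complex.I) *
    Complex.exp (((-(t ^ 2 / 2) * x : ℝ)) : ℂ) := by fun_prop
  have h3 := (h2.tendsto ⟪h, Q h⟫).comp hvar
  convert! h3 using 2
  rw [← Complex.exp_add]
  congr 1
  have : (((⟪h, Q h⟫.toNNReal : ℝ≥0) : ℝ) : ℂ) = ((⟪h, Q h⟫ : ℝ) : ℂ) := by
    rw [Real.coe_toNNReal _ hvar0]
  push_cast
  rw [this]
  ring

/-- The series shows that the choice in `gaussianMeasure` is not vacuous, and uniqueness identifies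
the chosen measure. -/
theorem gaussianMeasure_eq_gaussianSeriesLaw (b : HilbertBasis ι ℝ E) (u : E) {σ : ι → ℝ≥0}
    (hσ : Summable σ) {Q : E → E} (hQ : ∀ i v, ⟪b i, Q v⟫ = σ i * ⟪b i, v⟫) :
    gaussianMeasure u Q = gaussianSeriesLaw b u σ := by
  have := b.secondCountableTopology
  have h : ∃ μ : Measure E, IsGaussianLaw μ u Q := ⟨_, isGaussianLaw_gaussianSeriesLaw b u hσ hQ⟩
  rw [gaussianMeasure, dif_pos h]
  exact h.choose_spec.unique (isGaussianLaw_gaussianSeriesLaw b u hσ hQ)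

/-- Young's inequality `(x + y)² ≤ (1 + s) x² + (1 + s⁻¹) y²` separates the mean from the
fluctuation. Keeping `s` free lets the constant before `‖u‖²` tend to one, as the sharp bound on
`Z(η) / η` requires. -/
theorem lintegral_exp_norm_sq_gaussianSeriesLaw_le (b : HilbertBasis ι ℝ E) (u : E) {σ : ι → ℝ≥0}
    (hσ : Summable σ) {a s : ℝ} (ha : 0 ≤ a) (hs : 0 < s)
    (has : ∀ i, a * (1 + s⁻¹) * σ i ≤ 1 / 4) :
    ∫⁻ v, ENNReal.ofReal (Real.exp (a * ‖v‖ ^ 2)) ∂gaussianSeriesLaw b u σ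
      ≤ ENNReal.ofReal (Real.exp (a * (1 + s) * ‖u‖ ^ 2
        + 2 * (a * (1 + s⁻¹)) * ∑' i, (σ i : ℝ))) := by
  have hm : Measurable fun v : E => ENNReal.ofReal (Real.exp (a * ‖v‖ ^ 2)) := by fun_prop
  rw [gaussianSeriesLaw, lintegral_map' hm.aemeasurable (aemeasurable_add_basisSeries b u hσ)]
  have hpt : ∀ᵐ z ∂gaussianCoordinates σ,
      ENNReal.ofReal (Real.exp (a * ‖u + basisSeries b z‖ ^ 2)) ≤
        ENNReal.ofReal (Real.exp (a * (1 + s) * ‖u‖ ^ 2)) *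
          ENNReal.ofReal (Real.exp (a * (1 + s⁻¹) * ∑' i, z i ^ 2)) := by
    filter_upwards [ae_summable_sq_gaussianCoordinates hσ] with z hz
    rw [← ENNReal.ofReal_mul (Real.exp_pos _).le, ← Real.exp_add]
    refine ENNReal.ofReal_le_ofReal (Real.exp_le_exp.2 ?_)
    have h1 : ∑' i, z i ^ 2 = ‖basisSeries b z‖ ^ 2 := by
      simpa using (hasSum_norm_basisSeries_sub_sq b hz 0).tsum_eq
    rw [h1]
    set x := ‖u‖
    set y := ‖basisSeries b z‖
    have h2 : ‖u + basisSeries b z‖ ^ 2 ≤ (x + y) ^ 2 :=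
      pow_le_pow_left₀ (norm_nonneg _) (norm_add_le _ _) 2
    have h3 : (x + y) ^ 2 ≤ (1 + s) * x ^ 2 + (1 + s⁻¹) * y ^ 2 := by
      have h4 : (1 + s) * x ^ 2 + (1 + s⁻¹) * y ^ 2 - (x + y) ^ 2 = s⁻¹ * (s * x - y) ^ 2 := by
        field_simp
        ring
      have : 0 ≤ s⁻¹ * (s * x - y) ^ 2 := by positivity
      linarith
    calc a * ‖u + basisSeries b z‖ ^ 2 ≤ a * ((1 + s) * x ^ 2 + (1 + s⁻¹) * y ^ 2) := by
          gcongr; exact h2.trans h3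
      _ = _ := by ring
  refine (lintegral_mono_ae hpt).trans ?_
  rw [lintegral_const_mul' _ _ ENNReal.ofReal_ne_top, Real.exp_add,
    ENNReal.ofReal_mul (Real.exp_pos _).le]
  gcongr
  exact lintegral_exp_tsum_sq_gaussianCoordinates_le hσ (by positivity) has

/-- By Parseval, the squared distance to the centre is at most `|F| ρ²` from the box plus a tail
below `t`. -/
theorem half_prod_le_gaussianSeriesLaw_ball (b : HilbertBasis ι ℝ E) (u : E) {σ : ι → ℝ≥0}
    (hσ : Summable σ) (F : Finset ι) (c : ι → ℝ) {ρ t r : ℝ} (ht : 0 < t) (hr : 0 < r)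
    (hρr : F.card * ρ ^ 2 + t ≤ r ^ 2) (hσt : ∑' i, (σ i : ℝ) ≤ t / 2) :
    (∏ i ∈ F, gaussianReal 0 (σ i) (Metric.ball (c i) ρ)) / 2 ≤
      gaussianSeriesLaw b u σ (Metric.ball (u + ∑ i ∈ F, c i • b i) r) := by
  classical
  have hσ' : Summable fun i => (σ i : ℝ) := NNReal.summable_coe.2 hσ
  have hσt' : ∑' i, (σ i : ℝ≥0∞) ≤ ENNReal.ofReal t / 2 := by
    have h1 : ∑' i, (σ i : ℝ≥0∞) = ENNReal.ofReal (∑' i, (σ i : ℝ)) := by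
      rw [ENNReal.ofReal_tsum_of_nonneg (fun i => NNReal.coe_nonneg _) hσ']
      simp
    rw [h1]
    refine (ENNReal.ofReal_le_ofReal hσt).trans (le_of_eq ?_)
    rw [ENNReal.ofReal_div_of_pos two_pos, ENNReal.ofReal_ofNat]
  refine (half_prod_le_gaussianCoordinates F (fun i => Metric.isOpen_ball.measurableSet) ht
    hσt').trans ?_
  rw [gaussianSeriesLaw, Measure.map_apply_of_aemeasurable (aemeasurable_add_basisSeries b u hσ)
    Metric.isOpen_ball.measurableSet]
  refine measure_mono_ae ?_
  filter_upwards [ae_summable_sq_gaussianCoordinates hσ] with z hz hzA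
  obtain ⟨hzF, hzT⟩ := hzA
  change u + basisSeries b z ∈ Metric.ball (u + ∑ i ∈ F, c i • b i) r
  rw [Metric.mem_ball, dist_eq_norm, add_sub_add_left_eq_sub]
  refine lt_of_pow_lt_pow_left₀ 2 hr.le ?_
  set x := ∑ i ∈ F, c i • b i with hx
  have hbx : ∀ i, ⟪b i, x⟫ = if i ∈ F then c i else 0 := by
    intro i
    simp [hx, inner_sum, real_inner_smul_right, orthonormal_iff_ite.1 b.orthonormal]
  have hs := hasSum_norm_basisSeries_sub_sq b hz x
  rw [← hs.tsum_eq, ← hs.summable.sum_add_tsum_subtype_compl F]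
  have htail : ∑' i : {i // i ∉ F}, (z i - ⟪b i, x⟫) ^ 2 < t := by
    have h1 : ∀ i : {i // i ∉ F}, (z i - ⟪b i, x⟫) ^ 2 = z i ^ 2 := by
      intro i; rw [hbx, if_neg i.2, sub_zero]
    simp_rw [h1]
    rw [← ENNReal.ofReal_tsum_of_nonneg (fun i => sq_nonneg _) (hz.subtype _)] at hzT
    exact (ENNReal.ofReal_lt_ofReal_iff ht).1 hzT
  have hhead : ∑ i ∈ F, (z i - ⟪b i, x⟫) ^ 2 ≤ F.card * ρ ^ 2 := by
    rw [← nsmul_eq_mul]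
    refine Finset.sum_le_card_nsmul _ _ _ fun i hi => ?_
    rw [hbx, if_pos hi, ← sq_abs]
    have := hzF i hi
    rw [Metric.mem_ball, Real.dist_eq] at this
    exact pow_le_pow_left₀ (abs_nonneg _) this.le 2
  linarith

end Series

theorem IsGaussianLaw.measure_halfSpace_le {E : Type*} [NormedAddCommGroup E]
    [InnerProductSpace ℝ E] [MeasurableSpace E] [BorelSpace E] {μ : Measure E} {u : E} {Q : E → E}
    (hμ : IsGaussianLaw μ u Q) {h : E} {c w : ℝ} (hw : 0 < w) (hQ : ⟪h, Q h⟫ ≤ w)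
    (hc : ⟪h, u⟫ ≤ c) :
    μ {v | c ≤ ⟪h, v⟫} ≤ ENNReal.ofReal (Real.exp (-((c - ⟪h, u⟫) ^ 2 / (2 * w)))) := by
  have hm : Measurable fun v : E => ⟪h, v⟫ := (continuous_const.inner continuous_id).measurable
  have h1 : μ {v | c ≤ ⟪h, v⟫} = μ.map (fun v => ⟪h, v⟫) (Set.Ici c) :=
    (Measure.map_apply hm measurableSet_Ici).symm
  rw [h1, hμ h]
  refine gaussianReal_Ici_le hw ?_ hc
  rw [Real.coe_toNNReal']
  exact max_le hQ hw.le

/-! ### Weakly compact sets and half-spaces -/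

section WeakTopology

variable {E : Type*} [NormedAddCommGroup E] [InnerProductSpace ℝ E] [CompleteSpace E]

/-- Banach–Alaoglu in the dual, carried over by the Riesz isometry, which is continuous from the
weak-* to the weak topology because it turns functionals into evaluations. -/
theorem isCompact_toWeakSpace_image_closedBall (R : ℝ) :
    IsCompact (toWeakSpace ℝ E '' Metric.closedBall 0 R) := by
  set Φ : WeakDual ℝ E → WeakSpace ℝ E := fun f =>
    toWeakSpace ℝ E ((InnerProductSpace.toDual ℝ E).symm (WeakDual.toStrongDual f)) with hΦ
  have hcont : Continuous Φ := by
    refine WeakBilin.continuous_of_continuous_eval _ fun g => ?_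
    have h1 : ∀ f : WeakDual ℝ E, g ((InnerProductSpace.toDual ℝ E).symm (WeakDual.toStrongDual f))
        = f ((InnerProductSpace.toDual ℝ E).symm g) := by
      intro f
      have h2 : g ((InnerProductSpace.toDual ℝ E).symm (WeakDual.toStrongDual f))
          = ⟪(InnerProductSpace.toDual ℝ E).symm g,
            (InnerProductSpace.toDual ℝ E).symm (WeakDual.toStrongDual f)⟫ :=
        (InnerProductSpace.toDual_symm_apply (𝕜 := ℝ) (y := g)).symm
      rw [h2, real_inner_comm, InnerProductSpace.toDual_symm_apply]
      rfl
    exact (WeakDual.eval_continuous _).congr fun f => (h1 f).symm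
  have h := (WeakDual.isCompact_closedBall (𝕜 := ℝ) (0 : StrongDual ℝ E) R).image hcont
  convert h using 1
  ext w
  constructor
  · rintro ⟨v, hv, rfl⟩
    refine ⟨StrongDual.toWeakDual (InnerProductSpace.toDual ℝ E v), ?_, ?_⟩
    · simpa using hv
    · simp [hΦ]
  · rintro ⟨f, hf, rfl⟩
    exact ⟨_, by simpa using hf, rfl⟩

/-- The bounded part of a weakly closed set outside of a ball is covered by finitely many
half-spaces that do not meet the ball. -/
theorem exists_finset_halfSpace_cover {A : Set E} (hA : IsClosed (toWeakSpace ℝ E '' A)) (u : E)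
    (R : ℝ) {c : ℝ} (hc0 : 0 ≤ c) (hc : ∀ v ∈ A, c < ‖v - u‖) :
    ∃ T : Finset E, (∀ h ∈ T, ‖h‖ = 1) ∧
      ∀ v ∈ A, ‖v‖ ≤ R → ∃ h ∈ T, c ≤ ⟪h, v - u⟫ := by
  classical
  have hK : IsCompact (toWeakSpace ℝ E '' (A ∩ Metric.closedBall 0 R)) := by
    rw [Set.image_inter (toWeakSpace ℝ E).injective, Set.inter_comm]
    exact (isCompact_toWeakSpace_image_closedBall R).inter_right hA
  set U : {h : E // ‖h‖ = 1} → Set (WeakSpace ℝ E) := fun h =>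
    {w | c < ⟪(h : E), (toWeakSpace ℝ E).symm w - u⟫} with hU
  have hUo : ∀ h, IsOpen (U h) := by
    intro h
    have h1 : Continuous fun w : WeakSpace ℝ E => ⟪(h : E), (toWeakSpace ℝ E).symm w⟫ :=
      WeakBilin.eval_continuous (topDualPairing ℝ E).flip (InnerProductSpace.toDual ℝ E h)
    have h2 : Continuous fun w : WeakSpace ℝ E => ⟪(h : E), (toWeakSpace ℝ E).symm w - u⟫ := by
      simp only [inner_sub_right]
      exact h1.sub continuous_const
    exact isOpen_lt continuous_const h2
  obtain ⟨T, hT⟩ := hK.elim_finite_subcover U hUo (by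
    rintro _ ⟨v, ⟨hv, -⟩, rfl⟩
    have hpos : 0 < ‖v - u‖ := hc0.trans_lt (hc v hv)
    -- In the unit direction of `v - u`, the half-space functional at `v` equals the full distance
    -- `‖v - u‖`.
    refine Set.mem_iUnion.2 ⟨⟨‖v - u‖⁻¹ • (v - u), ?_⟩, ?_⟩
    · rw [norm_smul, norm_inv, norm_norm, inv_mul_cancel₀ hpos.ne']
    · simp only [hU, Set.mem_ofPred_eq, LinearEquiv.symm_apply_apply, real_inner_smul_left,
        real_inner_self_eq_norm_sq]
      have : ‖v - u‖⁻¹ * ‖v - u‖ ^ 2 = ‖v - u‖ := by field_simp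
      rw [this]
      exact hc v hv)
  refine ⟨T.image Subtype.val, ?_, fun v hv hvR => ?_⟩
  · intro h hh
    obtain ⟨x, -, rfl⟩ := Finset.mem_image.1 hh
    exact x.2
  · have hmem : toWeakSpace ℝ E v ∈ ⋃ i ∈ T, U i := hT ⟨v, ⟨hv, by simpa using hvR⟩, rfl⟩
    obtain ⟨h, hh, hhv⟩ := Set.mem_iUnion₂.1 hmem
    refine ⟨h, Finset.mem_image_of_mem _ hh, le_of_lt ?_⟩
    simpa [hU] using hhv

end WeakTopology

/-! ### From exponential bounds to large deviations -/

theorem coe_mul_log_le {ε x : ℝ} (hε : 0 < ε) {p : ℝ≥0∞}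
    (hp : p ≤ ENNReal.ofReal (Real.exp (x / ε))) : (ε : EReal) * ENNReal.log p ≤ x := by
  have h1 := ENNReal.log_le_log hp
  rw [ENNReal.log_ofReal_of_pos (Real.exp_pos _), Real.log_exp] at h1
  refine (mul_le_mul_of_nonneg_left h1 (EReal.coe_nonneg.2 hε.le)).trans (le_of_eq ?_)
  rw [← EReal.coe_mul, mul_div_cancel₀ _ hε.ne']

theorem le_coe_mul_log {ε x : ℝ} (hε : 0 < ε) {p : ℝ≥0∞}
    (hp : ENNReal.ofReal (Real.exp (x / ε)) ≤ p) : (x : EReal) ≤ (ε : EReal) * ENNReal.log p := by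
  have h1 := ENNReal.log_le_log hp
  rw [ENNReal.log_ofReal_of_pos (Real.exp_pos _), Real.log_exp] at h1
  refine (le_of_eq ?_).trans (mul_le_mul_of_nonneg_left h1 (EReal.coe_nonneg.2 hε.le))
  rw [← EReal.coe_mul, mul_div_cancel₀ _ hε.ne']

/-- Fixed prefactors, such as the number of half-spaces in a cover, cost an arbitrarily small amount
of rate. -/
theorem eventually_mul_exp_le (N : ℝ) {x y : ℝ} (hxy : x < y) :
    ∀ᶠ ε : ℝ in 𝓝[>] 0, N * Real.exp (x / ε) ≤ Real.exp (y / ε) := by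
  have h1 : Tendsto (fun ε : ℝ => Real.exp ((y - x) * ε⁻¹)) (𝓝[>] 0) atTop :=
    Real.tendsto_exp_atTop.comp
      ((tendsto_inv_nhdsGT_zero (𝕜 := ℝ)).const_mul_atTop (sub_pos.2 hxy))
  filter_upwards [h1.eventually_ge_atTop N] with ε hε
  have h2 : Real.exp (y / ε) = Real.exp ((y - x) * ε⁻¹) * Real.exp (x / ε) := by
    rw [← Real.exp_add]
    congr 1
    ring
  rw [h2]
  gcongr

section LargeDeviations

variable {E : Type*} [NormedAddCommGroup E] [MeasurableSpace E]

theorem limsup_log_measure_le [InnerProductSpace ℝ E] [CompleteSpace E] {μ : ℝ → Measure E} {u₀ : E}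
    (hprob : ∀ ε : ℝ, 0 < ε → IsProbabilityMeasure (μ ε))
    (htail : ∀ x : ℝ, ∃ R : ℝ, ∀ᶠ ε : ℝ in 𝓝[>] 0,
      μ ε {v | R ≤ ‖v‖} ≤ ENNReal.ofReal (Real.exp (-x / ε)))
    (hhalf : ∀ h : E, ‖h‖ = 1 → ∀ c x : ℝ, 0 ≤ c → x < c ^ 2 → ∀ᶠ ε : ℝ in 𝓝[>] 0,
      μ ε {v | c ≤ ⟪h, v - u₀⟫} ≤ ENNReal.ofReal (Real.exp (-x / ε)))
    {A : Set E} (hA : IsClosed (toWeakSpace ℝ E '' A)) :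
    limsup (fun ε : ℝ => (ε : EReal) * ENNReal.log (μ ε A)) (𝓝[>] 0)
      ≤ -⨅ u ∈ A, (ENNReal.ofReal (‖u - u₀‖ ^ 2) : EReal) := by
  rw [EReal.le_neg]
  refine EReal.ge_of_forall_gt_iff_ge.1 fun z hz => ?_
  rw [EReal.le_neg, ← EReal.coe_neg]
  refine limsup_le_of_le (by isBoundedDefault) ?_
  rcases lt_or_ge z 0 with hz0 | hz0
  · filter_upwards [self_mem_nhdsWithin] with ε hε
    have := hprob ε hε
    refine coe_mul_log_le hε (prob_le_one.trans ?_)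
    rw [← ENNReal.ofReal_one]
    refine ENNReal.ofReal_le_ofReal (Real.one_le_exp (div_nonneg (by linarith) (le_of_lt hε)))
  -- With `z < y` below the infimum, half-spaces at distance `√y` miss no bounded point of `A`. The
  -- intermediate rate `(z + y) / 2` leaves room for the half-space bound on one side and for the
  -- factor `T.card + 1` on the other.
  obtain ⟨y, hzy, hyA⟩ := EReal.lt_iff_exists_real_btwn.1 hz
  have hzy' : z < y := EReal.coe_lt_coe_iff.1 hzy
  have hy0 : 0 ≤ y := hz0.trans hzy'.le
  have hdist : ∀ v ∈ A, √y < ‖v - u₀‖ := by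
    intro v hv
    have h1 := hyA.trans_le (iInf₂_le v hv)
    rw [EReal.coe_ennreal_ofReal, max_eq_left (sq_nonneg _), EReal.coe_lt_coe_iff] at h1
    exact (Real.sqrt_lt' (by
      by_contra hcon
      have : ‖v - u₀‖ = 0 := le_antisymm (not_lt.1 hcon) (norm_nonneg _)
      rw [this] at h1
      linarith)).2 h1
  obtain ⟨R, hR⟩ := htail ((z + y) / 2)
  obtain ⟨T, hT1, hT⟩ := exists_finset_halfSpace_cover hA u₀ R (Real.sqrt_nonneg y) hdist
  have hTev : ∀ᶠ ε : ℝ in 𝓝[>] 0, ∀ h ∈ T,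
      μ ε {v | √y ≤ ⟪h, v - u₀⟫} ≤ ENNReal.ofReal (Real.exp (-((z + y) / 2) / ε)) :=
    (Filter.eventually_all_finset T).2 fun h hh =>
      hhalf h (hT1 h hh) _ _ (Real.sqrt_nonneg y) (by rw [Real.sq_sqrt hy0]; linarith)
  filter_upwards [self_mem_nhdsWithin, hR, hTev,
    eventually_mul_exp_le (T.card + 1) (show -((z + y) / 2) < -z by linarith)] with ε hε h1 h2 h3
  refine coe_mul_log_le hε (le_trans ?_ (ENNReal.ofReal_le_ofReal h3))
  have hcov : A ⊆ (⋃ h ∈ T, {v | √y ≤ ⟪h, v - u₀⟫}) ∪ {v | R ≤ ‖v‖} := by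
    intro v hv
    rcases le_or_gt R ‖v‖ with h | h
    · exact Or.inr h
    · obtain ⟨w, hw, hwv⟩ := hT v hv h.le
      exact Or.inl (Set.mem_iUnion₂.2 ⟨w, hw, hwv⟩)
  refine (measure_mono hcov).trans ((measure_union_le _ _).trans ?_)
  rw [ENNReal.ofReal_mul (by positivity), ENNReal.ofReal_add (by positivity) zero_le_one, add_mul,
    ENNReal.ofReal_one, one_mul, ENNReal.ofReal_natCast]
  gcongr
  refine (measure_biUnion_finset_le T _).trans ?_
  rw [← nsmul_eq_mul]
  exact Finset.sum_le_card_nsmul _ _ _ h2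

theorem le_liminf_log_measure {μ : ℝ → Measure E} {u₀ : E}
    (hball : ∀ v : E, ∀ r x : ℝ, 0 < r → ‖v - u₀‖ ^ 2 < x → ∀ᶠ ε : ℝ in 𝓝[>] 0,
      ENNReal.ofReal (Real.exp (-x / ε)) ≤ μ ε (Metric.ball v r))
    {U : Set E} (hU : IsOpen U) :
    -⨅ u ∈ U, (ENNReal.ofReal (‖u - u₀‖ ^ 2) : EReal)
      ≤ liminf (fun ε : ℝ => (ε : EReal) * ENNReal.log (μ ε U)) (𝓝[>] 0) := by
  rw [EReal.neg_le]
  refine le_iInf₂ fun v hv => ?_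
  rw [EReal.coe_ennreal_ofReal, max_eq_left (sq_nonneg _)]
  refine EReal.le_of_forall_lt_iff_le.1 fun x hx => ?_
  rw [EReal.neg_le, ← EReal.coe_neg]
  refine le_liminf_of_le (by isBoundedDefault) ?_
  obtain ⟨r, hr, hrU⟩ := Metric.isOpen_iff.1 hU v hv
  filter_upwards [self_mem_nhdsWithin, hball v r x hr (EReal.coe_lt_coe_iff.1 hx)] with ε hε h
  exact le_coe_mul_log hε (h.trans (measure_mono hrU))

theorem expMomentLimit_le {μ : ℝ → Measure E} {η y : ℝ}
    (h : ∀ x : ℝ, y < x → ∀ᶠ ε : ℝ in 𝓝[>] 0,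
      ∫⁻ v, ENNReal.ofReal (Real.exp (η * ‖v‖ ^ 2 / ε)) ∂μ ε ≤ ENNReal.ofReal (Real.exp (x / ε))) :
    expMomentLimit μ η ≤ y := by
  refine EReal.le_of_forall_lt_iff_le.1 fun x hx => ?_
  refine limsup_le_of_le (by isBoundedDefault) ?_
  filter_upwards [self_mem_nhdsWithin, h x (EReal.coe_lt_coe_iff.1 hx)] with ε hε h1
  exact coe_mul_log_le hε h1

theorem le_expMomentLimit {μ : ℝ → Measure E} {η y : ℝ}
    (h : ∀ x : ℝ, x < y → ∀ᶠ ε : ℝ in 𝓝[>] 0,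
      ENNReal.ofReal (Real.exp (x / ε)) ≤ ∫⁻ v, ENNReal.ofReal (Real.exp (η * ‖v‖ ^ 2 / ε)) ∂μ ε) :
    y ≤ expMomentLimit μ η := by
  refine EReal.ge_of_forall_gt_iff_ge.1 fun x hx => ?_
  refine le_limsup_of_frequently_le ?_ (by isBoundedDefault)
  refine Eventually.frequently ?_
  filter_upwards [self_mem_nhdsWithin, h x (EReal.coe_lt_coe_iff.1 hx)] with ε hε h1
  exact le_coe_mul_log hε h1

/-- Exponential bounds on balls, half-spaces and Gaussian moments imply the assumption on the
initial data, with the quadratic rate function `‖v - u₀‖²`. -/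
theorem initialDataAssumption_of_bounds [InnerProductSpace ℝ E] [CompleteSpace E] [BorelSpace E]
    {μ : ℝ → Measure E} {u₀ : E}
    (hprob : ∀ ε : ℝ, 0 < ε → IsProbabilityMeasure (μ ε))
    (hball : ∀ v : E, ∀ r x : ℝ, 0 < r → ‖v - u₀‖ ^ 2 < x → ∀ᶠ ε : ℝ in 𝓝[>] 0,
      ENNReal.ofReal (Real.exp (-x / ε)) ≤ μ ε (Metric.ball v r))
    (hhalf : ∀ h : E, ‖h‖ = 1 → ∀ c x : ℝ, 0 ≤ c → x < c ^ 2 → ∀ᶠ ε : ℝ in 𝓝[>] 0,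
      μ ε {v | c ≤ ⟪h, v - u₀⟫} ≤ ENNReal.ofReal (Real.exp (-x / ε)))
    (hexp : ∀ s : ℝ, 0 < s → ∀ᶠ η : ℝ in 𝓝[>] 0, ∀ x : ℝ, η * (1 + s) * ‖u₀‖ ^ 2 < x →
      ∀ᶠ ε : ℝ in 𝓝[>] 0, ∫⁻ v, ENNReal.ofReal (Real.exp (η * ‖v‖ ^ 2 / ε)) ∂μ ε
        ≤ ENNReal.ofReal (Real.exp (x / ε))) :
    InitialDataAssumption μ (fun v => ENNReal.ofReal (‖v - u₀‖ ^ 2)) := by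
  -- Exponential Chebyshev inequality at one fixed `η`: the radius `R = √w` is chosen with `η w ≥ x
  -- + y`.
  have htail : ∀ x : ℝ, ∃ R : ℝ, ∀ᶠ ε : ℝ in 𝓝[>] 0,
      μ ε {v | R ≤ ‖v‖} ≤ ENNReal.ofReal (Real.exp (-x / ε)) := by
    intro x
    obtain ⟨η, hη, hη0⟩ := ((hexp 1 one_pos).and self_mem_nhdsWithin).exists
    change 0 < η at hη0
    set y := η * (1 + 1) * ‖u₀‖ ^ 2 + 1
    set w := max 0 ((x + y) / η)
    have hw : x + y ≤ η * w := by
      have := le_max_right 0 ((x + y) / η)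
      rwa [div_le_iff₀' hη0] at this
    refine ⟨√w, ?_⟩
    filter_upwards [self_mem_nhdsWithin, hη y (lt_add_one _)] with ε hε hεη
    rw [Set.mem_Ioi] at hε
    have hm : Measurable fun v : E => ENNReal.ofReal (Real.exp (η * ‖v‖ ^ 2 / ε)) := by fun_prop
    have h1 := meas_ge_le_lintegral_div (μ := μ ε) hm.aemeasurable
      (ε := ENNReal.ofReal (Real.exp (η * w / ε))) (by simp [Real.exp_pos]) ENNReal.ofReal_ne_top
    have hsub : {v : E | √w ≤ ‖v‖} ⊆ {v : E | ENNReal.ofReal (Real.exp (η * w / ε))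
        ≤ ENNReal.ofReal (Real.exp (η * ‖v‖ ^ 2 / ε))} := by
      intro v hv
      refine ENNReal.ofReal_le_ofReal (Real.exp_le_exp.2 ?_)
      have : w ≤ ‖v‖ ^ 2 := (Real.sqrt_le_left (norm_nonneg _)).1 hv
      gcongr
    refine (measure_mono hsub).trans (h1.trans ((ENNReal.div_le_div_right hεη _).trans ?_))
    rw [← ENNReal.ofReal_div_of_pos (Real.exp_pos _), ← Real.exp_sub]
    refine ENNReal.ofReal_le_ofReal (Real.exp_le_exp.2 ?_)
    rw [← sub_div]
    gcongr
    linarith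
  refine ⟨hprob, fun A hA => limsup_log_measure_le hprob htail hhalf hA,
    fun U hU => le_liminf_log_measure hball hU, ?_, ⟨u₀, fun v => ?_, ?_⟩, ?_⟩
  · exact ENNReal.continuous_ofReal.comp (by fun_prop)
  · rw [ENNReal.ofReal_eq_zero, ← sub_eq_zero (a := v), ← norm_eq_zero]
    constructor
    · intro h
      exact pow_eq_zero_iff (two_ne_zero) |>.1 (le_antisymm h (sq_nonneg _))
    · intro h
      simp [h]
  · refine EReal.le_of_forall_lt_iff_le.1 fun y hy => ?_
    have hy' : ‖u₀‖ ^ 2 < y := EReal.coe_lt_coe_iff.1 hy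
    have hy0 : 0 < y := (sq_nonneg _).trans_lt hy'
    refine limsup_le_of_le (by isBoundedDefault) ?_
    rw [← nhdsLT_sup_nhdsGT, eventually_sup]
    constructor
    -- For `η < 0` division reverses the order, so `Z(η)` must be bounded below. On the ball of
    -- radius `√y - ‖u₀‖` around `u₀` one has `‖v‖² ≤ y`, and the rate vanishes at its centre.
    · have hlt : ‖u₀‖ < √y := Real.lt_sqrt_of_sq_lt hy'
      filter_upwards [self_mem_nhdsWithin] with η hη
      rw [Set.mem_Iio] at hη
      have hle : ((η * y : ℝ) : EReal) ≤ expMomentLimit μ η := by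
        refine le_expMomentLimit fun x hx => ?_
        filter_upwards [self_mem_nhdsWithin, hball u₀ (√y - ‖u₀‖) (η * y - x) (by linarith)
          (by simpa using hx)] with ε hε h1
        rw [Set.mem_Ioi] at hε
        have h2 : ∀ v ∈ Metric.ball u₀ (√y - ‖u₀‖), ENNReal.ofReal (Real.exp (η * y / ε))
            ≤ ENNReal.ofReal (Real.exp (η * ‖v‖ ^ 2 / ε)) := by
          intro v hv
          refine ENNReal.ofReal_le_ofReal (Real.exp_le_exp.2 ?_)
          have h3 : ‖v‖ ≤ √y := by
            rw [Metric.mem_ball, dist_eq_norm] at hv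
            have := norm_sub_norm_le v u₀
            linarith
          have h4 : ‖v‖ ^ 2 ≤ y := (Real.le_sqrt (norm_nonneg _) hy0.le).1 h3
          exact div_le_div_of_nonneg_right (mul_le_mul_of_nonpos_left h4 hη.le) hε.le
        refine le_trans ?_ (setLIntegral_le_lintegral (Metric.ball u₀ (√y - ‖u₀‖)) _)
        refine le_trans ?_ (setLIntegral_mono' Metric.isOpen_ball.measurableSet h2)
        rw [setLIntegral_const]
        refine le_trans (le_of_eq ?_) (mul_le_mul_right h1 _)
        rw [← ENNReal.ofReal_mul (Real.exp_pos _).le, ← Real.exp_add]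
        congr 2
        ring
      refine (EReal.div_le_div_right_of_nonpos (EReal.coe_nonpos.2 hη.le) hle).trans (le_of_eq ?_)
      rw [← EReal.coe_div, mul_div_cancel_left₀ _ hη.ne]
    -- For `η > 0` the moment bound is used with `s` so small that `(1 + s) ‖u₀‖² ≤ y`; the `+ 1`
    -- avoids dividing by zero when `u₀ = 0`.
    · set s := (y - ‖u₀‖ ^ 2) / (‖u₀‖ ^ 2 + 1) with hs
      have hs0 : 0 < s := div_pos (sub_pos.2 hy') (by positivity)
      have hsy : (1 + s) * ‖u₀‖ ^ 2 ≤ y := by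
        have : s * (‖u₀‖ ^ 2 + 1) = y - ‖u₀‖ ^ 2 := by
          rw [hs]; field_simp
        nlinarith
      filter_upwards [self_mem_nhdsWithin, hexp s hs0] with η hη h1
      rw [Set.mem_Ioi] at hη
      rw [EReal.div_le_iff_le_mul (EReal.coe_pos.2 hη) (EReal.coe_ne_top _), ← EReal.coe_mul]
      refine (expMomentLimit_le h1).trans (EReal.coe_le_coe_iff.2 ?_)
      rw [mul_assoc]
      gcongr
  · filter_upwards [self_mem_nhdsWithin, hexp 1 one_pos] with η hη h1
    rw [Set.mem_Ioi] at hη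
    have hle := expMomentLimit_le h1
    have hge : ((0 : ℝ) : EReal) ≤ expMomentLimit μ η := by
      refine le_expMomentLimit fun x hx => ?_
      filter_upwards [self_mem_nhdsWithin] with ε hε
      rw [Set.mem_Ioi] at hε
      have := hprob ε hε
      calc ENNReal.ofReal (Real.exp (x / ε)) ≤ ENNReal.ofReal 1 :=
            ENNReal.ofReal_le_ofReal (Real.exp_le_one_iff.2 (div_nonpos_of_nonpos_of_nonneg hx.le hε.le))
        _ = ∫⁻ _, 1 ∂μ ε := by simp
        _ ≤ _ := by
          refine lintegral_mono fun v => ?_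
          rw [← ENNReal.ofReal_one]
          exact ENNReal.ofReal_le_ofReal (Real.one_le_exp (by positivity))
    exact ⟨ne_top_of_le_ne_top (EReal.coe_ne_top _) hle, ne_bot_of_le_ne_bot (EReal.coe_ne_bot _) hge⟩

end LargeDeviations

/-! ### Gaussian measures with diagonal covariance -/

/-- Small-noise Gaussian measures with covariances `(ε / 2) Q ε`, where `Q ε` is diagonal in a fixed
Hilbert basis, bounded by the identity and of trace `o(1 / ε)`, and tends to the identity on the basis
vectors, satisfy the assumption on the initial data. -/
theorem initialDataAssumption_of_diagonal {ι E : Type*} [Countable ι] [NormedAddCommGroup E]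
    [InnerProductSpace ℝ E] [CompleteSpace E] [MeasurableSpace E] [BorelSpace E]
    (b : HilbertBasis ι ℝ E) {u : ℝ → E} {u₀ : E} {q : ℝ → ι → ℝ} {Q : ℝ → E → E}
    (hQ : ∀ ε, 0 < ε → ∀ i v, ⟪b i, Q ε v⟫ = q ε i * ⟪b i, v⟫)
    (hq0 : ∀ ε, 0 < ε → ∀ i, 0 ≤ q ε i) (hq1 : ∀ ε, 0 < ε → ∀ i, q ε i ≤ 1)
    (hsum : ∀ ε, 0 < ε → Summable (q ε)) (hu : Tendsto u (𝓝[>] 0) (𝓝 u₀))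
    (hq : ∀ i, Tendsto (fun ε => q ε i) (𝓝[>] 0) (𝓝 1))
    (htr : Tendsto (fun ε => ε * ∑' i, q ε i) (𝓝[>] 0) (𝓝 0)) :
    InitialDataAssumption (fun ε => gaussianMeasure (u ε) (fun h => (ε / 2) • Q ε h))
      (fun v => ENNReal.ofReal (‖v - u₀‖ ^ 2)) := by
  classical
  set σ : ℝ → ι → ℝ≥0 := fun ε i => (ε / 2 * q ε i).toNNReal with hσdef
  have hσ : ∀ ε, 0 < ε → ∀ i, (σ ε i : ℝ) = ε / 2 * q ε i := fun ε hε i =>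
    Real.coe_toNNReal _ (mul_nonneg (by linarith) (hq0 ε hε i))
  have hσs : ∀ ε, 0 < ε → Summable (σ ε) := fun ε hε => by
    rw [← NNReal.summable_coe]
    simp_rw [hσ ε hε]
    exact (hsum ε hε).mul_left _
  have hσt : ∀ ε, 0 < ε → ∑' i, (σ ε i : ℝ) = ε * (∑' i, q ε i) / 2 := fun ε hε => by
    simp_rw [hσ ε hε]
    rw [tsum_mul_left]
    ring
  have hσε : ∀ ε, 0 < ε → ∀ i, (σ ε i : ℝ) ≤ ε / 2 := fun ε hε i => by
    rw [hσ ε hε]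
    have := hq1 ε hε i
    nlinarith
  have hdiag : ∀ ε, 0 < ε → ∀ i v, ⟪b i, (ε / 2) • Q ε v⟫ = σ ε i * ⟪b i, v⟫ := by
    intro ε hε i v
    rw [real_inner_smul_right, hQ ε hε, hσ ε hε]
    ring
  have hμ : ∀ ε, 0 < ε → gaussianMeasure (u ε) (fun h => (ε / 2) • Q ε h)
      = gaussianSeriesLaw b (u ε) (σ ε) := fun ε hε =>
    gaussianMeasure_eq_gaussianSeriesLaw b (u ε) (hσs ε hε) (hdiag ε hε)
  refine initialDataAssumption_of_bounds ?_ ?_ ?_ ?_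
  · intro ε hε
    rw [hμ ε hε]
    exact isProbabilityMeasure_gaussianSeriesLaw b (u ε) (hσs ε hε)
  · intro v r x hr hx
    set d := v - u₀ with hd
    set c : ι → ℝ := fun i => ⟪b i, d⟫ with hc
    obtain ⟨F, hF⟩ : ∃ F : Finset ι, ‖∑ i ∈ F, c i • b i - d‖ < r / 4 := by
      have h1 : HasSum (fun i => c i • b i) d := by
        refine (b.hasSum_repr d).congr_fun fun i => ?_
        rw [b.repr_apply_apply]
      have h2 := (Metric.tendsto_nhds.1 h1 (r / 4) (by linarith)).exists
      simpa only [dist_eq_norm] using h2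
    -- Bessel's inequality, written as the value at `ρ = 0` of a continuous function, so that it
    -- persists for small `ρ > 0`.
    have hFsum : ∑ i ∈ F, (|c i| + 0) ^ 2 < x := by
      refine lt_of_le_of_lt ?_ hx
      simp only [add_zero, sq_abs]
      exact sum_le_hasSum F (fun i _ => sq_nonneg _) (b.hasSum_sq_inner d)
    obtain ⟨ρ, ⟨hρ1, hρ2⟩, hρ0⟩ : ∃ ρ : ℝ, (F.card * ρ ^ 2 < r ^ 2 / 8 ∧
        ∑ i ∈ F, (|c i| + ρ) ^ 2 < x) ∧ 0 < ρ := by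
      have h1 : Continuous fun ρ : ℝ => F.card * ρ ^ 2 := by fun_prop
      have h2 : Continuous fun ρ : ℝ => ∑ i ∈ F, (|c i| + ρ) ^ 2 := by fun_prop
      have e1 := (h1.tendsto 0).eventually_lt_const (u := r ^ 2 / 8) (by simp; positivity)
      have e2 := (h2.tendsto 0).eventually_lt_const hFsum
      exact (((e1.and e2).filter_mono nhdsWithin_le_nhds).and
        (self_mem_nhdsWithin (s := Set.Ioi (0 : ℝ)))).exists
    obtain ⟨y, hy1, hy2⟩ := exists_between hρ2
    have hqlim : Tendsto (fun ε => ∑ i ∈ F, (|c i| + ρ) ^ 2 / q ε i) (𝓝[>] 0)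
        (𝓝 (∑ i ∈ F, (|c i| + ρ) ^ 2)) := by
      have h1 : Tendsto (fun ε => ∑ i ∈ F, (|c i| + ρ) ^ 2 / q ε i) (𝓝[>] 0)
          (𝓝 (∑ i ∈ F, (|c i| + ρ) ^ 2 / 1)) :=
        tendsto_finsetSum F fun i _ => tendsto_const_nhds.div (hq i) one_ne_zero
      simpa using h1
    have hqpos : ∀ᶠ ε in 𝓝[>] (0 : ℝ), ∀ i ∈ F, 0 < q ε i :=
      (Filter.eventually_all_finset F).2 fun i _ => (hq i).eventually_const_lt one_pos
    -- Since the variances are at most `ε / 2`, this is the smallness that `le_gaussianReal_ball`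
    -- asks for.
    have hεsmall : ∀ᶠ ε in 𝓝[>] (0 : ℝ), Real.pi * ε < (2 * ρ) ^ 2 := by
      have h1 : Continuous fun ε : ℝ => Real.pi * ε := by fun_prop
      exact ((h1.tendsto 0).eventually_lt_const (by rw [mul_zero]; positivity)).filter_mono
        nhdsWithin_le_nhds
    have hudist : ∀ᶠ ε in 𝓝[>] (0 : ℝ), ‖u ε - u₀‖ < r / 4 := by
      have := Metric.tendsto_nhds.1 hu (r / 4) (by linarith)
      simpa only [dist_eq_norm] using this
    filter_upwards [self_mem_nhdsWithin, hqlim.eventually_lt_const hy1, hqpos, hεsmall, hudist,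
      htr.eventually_lt_const (show (0 : ℝ) < r ^ 2 / 8 by positivity),
      eventually_mul_exp_le 2 (show -x < -y by linarith)] with ε hε e1 e2 e3 e4 e5 e6
    rw [Set.mem_Ioi] at hε
    rw [hμ ε hε]
    have hsub : Metric.ball (u ε + ∑ i ∈ F, c i • b i) (r / 2) ⊆ Metric.ball v r := by
      refine Metric.ball_subset_ball' ?_
      rw [dist_eq_norm]
      have h1 : u ε + ∑ i ∈ F, c i • b i - v = (u ε - u₀) + (∑ i ∈ F, c i • b i - d) := by
        rw [hd]; abel
      have h2 := norm_add_le (u ε - u₀) (∑ i ∈ F, c i • b i - d)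
      rw [h1]
      linarith
    refine le_trans ?_ (measure_mono hsub)
    -- Box and tail each use `r² / 8` of the squared radius `(r / 2)²`; the other half of `r` paid
    -- for moving the centre.
    refine le_trans ?_ (half_prod_le_gaussianSeriesLaw_ball b (u ε) (hσs ε hε) F c
      (ρ := ρ) (t := r ^ 2 / 8) (by positivity) (by linarith) (by linarith)
      (by rw [hσt ε hε]; linarith))
    have hfac : ∀ i ∈ F, ENNReal.ofReal (Real.exp (-((|c i| + ρ) ^ 2 / q ε i) / ε))
        ≤ gaussianReal 0 (σ ε i) (Metric.ball (c i) ρ) := by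
      intro i hi
      have hσi : (0 : ℝ) < σ ε i := by
        rw [hσ ε hε]
        exact mul_pos (by linarith) (e2 i hi)
      have h1 : √(2 * Real.pi * σ ε i) ≤ 2 * ρ := by
        refine Real.sqrt_le_iff.2 ⟨by positivity, le_trans ?_ e3.le⟩
        have := mul_le_mul_of_nonneg_left (hσε ε hε i) (show 0 ≤ 2 * Real.pi by positivity)
        linarith
      refine le_trans (le_of_eq ?_)
        (le_gaussianReal_ball (v := σ ε i) (by exact_mod_cast hσi.ne') (h := c i) h1)
      congr 2
      rw [hσ ε hε]
      have := (e2 i hi).ne'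
      field_simp
    have hprod := Finset.prod_le_prod' hfac
    rw [← ENNReal.ofReal_prod_of_nonneg fun i _ => (Real.exp_pos _).le, ← Real.exp_sum] at hprod
    rw [ENNReal.le_div_iff_mul_le (by simp) (by simp), mul_comm]
    refine le_trans ?_ hprod
    rw [← ENNReal.ofReal_ofNat 2, ← ENNReal.ofReal_mul zero_le_two]
    refine ENNReal.ofReal_le_ofReal (e6.trans (Real.exp_le_exp.2 ?_))
    rw [← Finset.sum_div, Finset.sum_neg_distrib]
    gcongr
  · intro h hh c x hc hx
    rcases lt_or_ge x 0 with hx0 | hx0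
    · filter_upwards [self_mem_nhdsWithin] with ε hε
      rw [Set.mem_Ioi] at hε
      rw [hμ ε hε]
      have := isProbabilityMeasure_gaussianSeriesLaw b (u ε) (hσs ε hε)
      refine prob_le_one.trans ?_
      rw [← ENNReal.ofReal_one]
      exact ENNReal.ofReal_le_ofReal (Real.one_le_exp (div_nonneg (by linarith) hε.le))
    have hc0 : 0 < c := by
      rcases hc.eq_or_lt with h0 | h0
      · rw [← h0] at hx
        norm_num at hx
        linarith
      · exact h0
    have hlim : Tendsto (fun ε => c + ⟪h, u₀⟫ - ⟪h, u ε⟫) (𝓝[>] 0) (𝓝 c) := by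
      have h1 : Tendsto (fun ε => ⟪h, u ε⟫) (𝓝[>] 0) (𝓝 ⟪h, u₀⟫) := tendsto_const_nhds.inner hu
      simpa using (tendsto_const_nhds (x := c + ⟪h, u₀⟫)).sub h1
    filter_upwards [self_mem_nhdsWithin, hlim.eventually_const_lt hc0,
      (hlim.pow 2).eventually_const_lt hx] with ε hε e1 e2
    rw [Set.mem_Ioi] at hε
    have hlaw := isGaussianLaw_gaussianSeriesLaw b (u ε) (hσs ε hε) (hdiag ε hε)
    have hvar : ⟪h, (ε / 2) • Q ε h⟫ ≤ ε / 2 := by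
      have h1 := b.hasSum_inner_mul_inner h ((ε / 2) • Q ε h)
      have h2 := (b.hasSum_sq_inner h).mul_left (ε / 2)
      rw [hh, one_pow, mul_one] at h2
      refine hasSum_le (fun i => ?_) h1 h2
      rw [hdiag ε hε, real_inner_comm h (b i)]
      have := mul_le_mul_of_nonneg_right (hσε ε hε i) (sq_nonneg ⟪b i, h⟫)
      rw [real_inner_comm]
      linarith
    have hset : {v : E | c ≤ ⟪h, v - u₀⟫} = {v | c + ⟪h, u₀⟫ ≤ ⟪h, v⟫} := by
      ext v
      simp only [Set.mem_ofPred_eq, inner_sub_right, le_sub_iff_add_le]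
    rw [hμ ε hε, hset]
    refine (hlaw.measure_halfSpace_le (half_pos hε) hvar (by linarith)).trans ?_
    refine ENNReal.ofReal_le_ofReal (Real.exp_le_exp.2 ?_)
    rw [mul_div_cancel₀ _ two_ne_zero, ← neg_div]
    gcongr
  · intro s hs
    -- With variances at most `ε / 2`, this is the `1 / 4` condition for `a = η / ε`, uniformly in
    -- `ε`.
    have hηsmall : ∀ᶠ η in 𝓝[>] (0 : ℝ), η * (1 + s⁻¹) < 1 / 2 := by
      have h1 : Continuous fun η : ℝ => η * (1 + s⁻¹) := by fun_prop
      exact ((h1.tendsto 0).eventually_lt_const (by rw [zero_mul]; norm_num)).filter_mono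
        nhdsWithin_le_nhds
    filter_upwards [self_mem_nhdsWithin, hηsmall] with η hη hηs x hx
    rw [Set.mem_Ioi] at hη
    have hlim : Tendsto (fun ε => η * (1 + s) * ‖u ε‖ ^ 2 + η * (1 + s⁻¹) * (ε * ∑' i, q ε i))
        (𝓝[>] 0) (𝓝 (η * (1 + s) * ‖u₀‖ ^ 2)) := by
      have h1 := ((hu.norm.pow 2).const_mul (η * (1 + s))).add (htr.const_mul (η * (1 + s⁻¹)))
      simpa using h1
    filter_upwards [self_mem_nhdsWithin, hlim.eventually_lt_const hx] with ε hε e1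
    rw [Set.mem_Ioi] at hε
    rw [hμ ε hε]
    have h1 := lintegral_exp_norm_sq_gaussianSeriesLaw_le b (u ε) (hσs ε hε) (a := η / ε) (s := s)
      (by positivity) hs (fun i => by
        have h2 := mul_le_mul_of_nonneg_left (hσε ε hε i)
          (show 0 ≤ η / ε * (1 + s⁻¹) by positivity)
        have h3 : η / ε * (1 + s⁻¹) * (ε / 2) = η * (1 + s⁻¹) / 2 := by field_simp
        linarith)
    have h4 : ∀ v : E, η * ‖v‖ ^ 2 / ε = η / ε * ‖v‖ ^ 2 := fun v => by ring
    simp_rw [h4]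
    refine h1.trans (ENNReal.ofReal_le_ofReal (Real.exp_le_exp.2 ?_))
    rw [hσt ε hε]
    calc η / ε * (1 + s) * ‖u ε‖ ^ 2 + 2 * (η / ε * (1 + s⁻¹)) * (ε * (∑' i, q ε i) / 2)
        = (η * (1 + s) * ‖u ε‖ ^ 2 + η * (1 + s⁻¹) * (ε * ∑' i, q ε i)) / ε := by ring
      _ ≤ x / ε := by gcongr

/-! ### Calculus on the torus -/

/-- The covering map `ℝ³ → 𝕋³`. -/
def toTorus (X : R3) : Torus3 := fun i => (X i : UnitAddCircle)

/-- The periodic function on `ℝ³` that corresponds to a function on the torus. -/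
def torusLift {F : Type*} (f : Torus3 → F) (X : R3) : F := f (toTorus X)

/-- The partial derivative of a function on the torus. -/
def torusDeriv (j : Fin 3) (f : Torus3 → ℝ) (x : Torus3) : ℝ :=
  deriv (fun t : ℝ => f (x + Pi.single j (t : UnitAddCircle))) 0

/-- The Laplacian of a function on the torus. -/
def torusLaplacian (f : Torus3 → ℝ) (x : Torus3) : ℝ := ∑ j, torusDeriv j (torusDeriv j f) x

theorem isOpenQuotientMap_toTorus : IsOpenQuotientMap toTorus := by
  have h1 : IsOpenQuotientMap (Pi.map fun _ : Fin 3 => (QuotientAddGroup.mk : ℝ → UnitAddCircle)) :=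
    IsOpenQuotientMap.piMap fun _ => QuotientAddGroup.isOpenQuotientMap_mk
  exact h1.comp (EuclideanSpace.equiv (Fin 3) ℝ).toHomeomorph.isOpenQuotientMap

theorem continuous_of_torusLift {F : Type*} [TopologicalSpace F] {f : Torus3 → F}
    (hf : Continuous (torusLift f)) : Continuous f :=
  isOpenQuotientMap_toTorus.isQuotientMap.continuous_iff.2 hf

theorem toTorus_add_single (X : R3) (j : Fin 3) (t : ℝ) :
    toTorus X + Pi.single j (t : UnitAddCircle) = toTorus (X + t • EuclideanSpace.single j 1) := by
  ext i
  rcases eq_or_ne i j with rfl | h <;> simp [toTorus, *]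

theorem hasDerivAt_torusLift {f : Torus3 → ℝ} (hf : Differentiable ℝ (torusLift f)) (X : R3)
    (j : Fin 3) (t : ℝ) :
    HasDerivAt (fun t : ℝ => f (toTorus X + Pi.single j (t : UnitAddCircle)))
      (fderiv ℝ (torusLift f) (X + t • EuclideanSpace.single j 1) (EuclideanSpace.single j 1))
      t := by
  have h1 : HasDerivAt (fun t : ℝ => X + t • (EuclideanSpace.single j 1 : R3))
      (EuclideanSpace.single j 1) t := by
    simpa using ((hasDerivAt_id t).smul_const (EuclideanSpace.single j 1 : R3)).const_add X
  have h2 := ((hf _).hasFDerivAt).comp_hasDerivAt t h1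
  refine h2.congr_of_eventuallyEq (Eventually.of_forall fun s => ?_)
  simp only [Function.comp_apply, torusLift, toTorus_add_single]

theorem torusLift_torusDeriv {f : Torus3 → ℝ} (hf : Differentiable ℝ (torusLift f)) (j : Fin 3) :
    torusLift (torusDeriv j f)
      = fun X => fderiv ℝ (torusLift f) X (EuclideanSpace.single j 1) := by
  ext X
  simpa [torusLift, torusDeriv] using (hasDerivAt_torusLift hf X j 0).deriv

theorem hasDerivAt_torus {f : Torus3 → ℝ} (hf : Differentiable ℝ (torusLift f)) (x : Torus3)
    (j : Fin 3) (t : ℝ) :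
    HasDerivAt (fun t : ℝ => f (x + Pi.single j (t : UnitAddCircle)))
      (torusDeriv j f (x + Pi.single j (t : UnitAddCircle))) t := by
  obtain ⟨X, rfl⟩ := isOpenQuotientMap_toTorus.surjective x
  rw [toTorus_add_single]
  have h := congrFun (torusLift_torusDeriv hf j) (X + t • EuclideanSpace.single j 1)
  change torusDeriv j f _ = _ at h
  rw [h]
  exact hasDerivAt_torusLift hf X j t

theorem ContDiff.torusLift_torusDeriv {f : Torus3 → ℝ} (hf : ContDiff ℝ ∞ (torusLift f))
    (j : Fin 3) : ContDiff ℝ ∞ (torusLift (torusDeriv j f)) := by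
  rw [_root_.torusLift_torusDeriv (hf.differentiable (by simp)) j]
  exact (hf.fderiv_right (m := ∞) (by simp)).clm_apply contDiff_const

theorem ContDiff.continuous_of_torusLift {F : Type*} [NormedAddCommGroup F] [NormedSpace ℝ F]
    {f : Torus3 → F} (hf : ContDiff ℝ ∞ (torusLift f)) : Continuous f :=
  _root_.continuous_of_torusLift hf.continuous

theorem integrable_of_continuous_torus {F : Type*} [NormedAddCommGroup F] {f : Torus3 → F}
    (hf : Continuous f) : Integrable f torusMeasure :=
  hf.integrable_of_hasCompactSupport (HasCompactSupport.of_compactSpace f)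

/-- By translation invariance, the integral of `f(x + t eⱼ)` does not depend on `t`; differentiate
under the integral at `t = 0`. -/
theorem integral_torusDeriv_eq_zero {f : Torus3 → ℝ} (hf : ContDiff ℝ ∞ (torusLift f))
    (j : Fin 3) : ∫ x, torusDeriv j f x ∂torusMeasure = 0 := by
  have hd : Differentiable ℝ (torusLift f) := hf.differentiable (by simp)
  have hfc := hf.continuous_of_torusLift
  have hDc := (hf.torusLift_torusDeriv j).continuous_of_torusLift
  obtain ⟨C, hC⟩ := (isCompact_range hDc).isBounded.exists_norm_le
  have hshift : ∀ t : ℝ, Continuous fun x : Torus3 => x + Pi.single j (t : UnitAddCircle) :=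
    fun t => by fun_prop
  have h := (hasDerivAt_integral_of_dominated_loc_of_deriv_le (μ := torusMeasure) (x₀ := (0 : ℝ))
    (s := Set.univ) (F := fun (t : ℝ) x => f (x + Pi.single j (t : UnitAddCircle)))
    (F' := fun (t : ℝ) x => torusDeriv j f (x + Pi.single j (t : UnitAddCircle)))
    (bound := fun _ => C) Filter.univ_mem
    (Eventually.of_forall fun t => Continuous.aestronglyMeasurable (hfc.comp (hshift t)))
    (integrable_of_continuous_torus (hfc.comp (hshift 0)))
    (Continuous.aestronglyMeasurable (hDc.comp (hshift 0)))
    (ae_of_all _ fun x t _ => hC _ (Set.mem_range_self _)) (integrable_const C)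
    (ae_of_all _ fun x t _ => hasDerivAt_torus hd x j t)).2
  have hconst : (fun t : ℝ => ∫ x, f (x + Pi.single j (t : UnitAddCircle)) ∂torusMeasure)
      = fun _ => ∫ x, f x ∂torusMeasure := by
    ext t
    exact integral_add_right_eq_self f _
  rw [hconst] at h
  simpa using h.unique (hasDerivAt_const (0 : ℝ) (∫ x, f x ∂torusMeasure))

theorem torusDeriv_mul {f g : Torus3 → ℝ} (hf : Differentiable ℝ (torusLift f))
    (hg : Differentiable ℝ (torusLift g)) (j : Fin 3) (x : Torus3) :
    torusDeriv j (fun x => f x * g x) x = torusDeriv j f x * g x + f x * torusDeriv j g x := by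
  change deriv (fun t : ℝ => f (x + Pi.single j (t : UnitAddCircle))
    * g (x + Pi.single j (t : UnitAddCircle))) 0 = _
  simpa using
    ((hasDerivAt_torus hf x j 0).fun_mul (hasDerivAt_torus hg x j 0)).deriv

theorem ContDiff.torusLift_mul {f g : Torus3 → ℝ} (hf : ContDiff ℝ ∞ (torusLift f))
    (hg : ContDiff ℝ ∞ (torusLift g)) : ContDiff ℝ ∞ (torusLift fun x => f x * g x) :=
  hf.mul hg

theorem integral_torusDeriv_mul {f g : Torus3 → ℝ} (hf : ContDiff ℝ ∞ (torusLift f))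
    (hg : ContDiff ℝ ∞ (torusLift g)) (j : Fin 3) :
    ∫ x, torusDeriv j f x * g x ∂torusMeasure = -∫ x, f x * torusDeriv j g x ∂torusMeasure := by
  have h := integral_torusDeriv_eq_zero (hf.torusLift_mul hg) j
  simp_rw [torusDeriv_mul (hf.differentiable (by simp)) (hg.differentiable (by simp))] at h
  have cf := hf.continuous_of_torusLift
  have cg := hg.continuous_of_torusLift
  have cf' := (hf.torusLift_torusDeriv j).continuous_of_torusLift
  have cg' := (hg.torusLift_torusDeriv j).continuous_of_torusLift
  rw [integral_add (integrable_of_continuous_torus (by fun_prop))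
    (integrable_of_continuous_torus (by fun_prop))] at h
  linarith

/-- Green's second identity on the torus. -/
theorem integral_torusLaplacian_mul {f g : Torus3 → ℝ} (hf : ContDiff ℝ ∞ (torusLift f))
    (hg : ContDiff ℝ ∞ (torusLift g)) :
    ∫ x, torusLaplacian f x * g x ∂torusMeasure = ∫ x, f x * torusLaplacian g x ∂torusMeasure := by
  have cf := hf.continuous_of_torusLift
  have cg := hg.continuous_of_torusLift
  have cf' := fun j => ((hf.torusLift_torusDeriv j).torusLift_torusDeriv j).continuous_of_torusLift
  have cg' := fun j => ((hg.torusLift_torusDeriv j).torusLift_torusDeriv j).continuous_of_torusLift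
  simp only [torusLaplacian, Finset.sum_mul, Finset.mul_sum]
  rw [integral_finsetSum _ fun j _ => integrable_of_continuous_torus ((cf' j).fun_mul cg),
    integral_finsetSum _ fun j _ => integrable_of_continuous_torus (cf.fun_mul (cg' j))]
  refine Finset.sum_congr rfl fun j _ => ?_
  rw [integral_torusDeriv_mul (hf.torusLift_torusDeriv j) hg,
    integral_torusDeriv_mul hf (hg.torusLift_torusDeriv j), neg_neg]

theorem laplacian_torusLift {f : Torus3 → ℝ} (hf : ContDiff ℝ ∞ (torusLift f)) :
    Laplacian.laplacian (torusLift f) = torusLift (torusLaplacian f) := by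
  ext X
  rw [InnerProductSpace.laplacian_eq_iteratedFDeriv_orthonormalBasis _
    (EuclideanSpace.basisFun (Fin 3) ℝ)]
  change _ = ∑ j, torusLift (torusDeriv j (torusDeriv j f)) X
  refine Finset.sum_congr rfl fun j _ => ?_
  rw [torusLift_torusDeriv ((hf.torusLift_torusDeriv j).differentiable (by simp)),
    torusLift_torusDeriv (hf.differentiable (by simp)), iteratedFDeriv_two_apply]
  have hd : DifferentiableAt ℝ (fderiv ℝ (torusLift f)) X :=
    (hf.fderiv_right (m := ∞) (by simp)).differentiable (by simp) X
  dsimp only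
  rw [fderiv_clm_apply hd (differentiableAt_const _)]
  simp

/-! ### Trigonometric functions on the torus -/

/-- The phase `2π k·X`. -/
def phase (k : Fin 3 → ℤ) (X : R3) : ℝ := 2 * Real.pi * ∑ i, k i * X i

theorem mFourier_toTorus (k : Fin 3 → ℤ) (X : R3) :
    UnitAddTorus.mFourier k (toTorus X) = Complex.exp (phase k X * Complex.I) := by
  change ∏ i, fourier (k i) ((X i : ℝ) : UnitAddCircle) = _
  simp_rw [fourier_coe_apply]
  rw [← Complex.exp_sum]
  congr 1
  simp only [phase, Complex.ofReal_one, div_one]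
  push_cast
  rw [Finset.mul_sum, Finset.sum_mul]
  exact Finset.sum_congr rfl fun i _ => by ring

/-- `cos(2πk·x) + sin(2πk·x)`. -/
def cas (k : Fin 3 → ℤ) (x : Torus3) : ℝ :=
  (UnitAddTorus.mFourier k x).re + (UnitAddTorus.mFourier k x).im

theorem torusLift_mFourier_re (k : Fin 3 → ℤ) :
    torusLift (fun x => (UnitAddTorus.mFourier k x).re) = fun X => Real.cos (phase k X) := by
  ext X
  simp only [torusLift, mFourier_toTorus, Complex.exp_ofReal_mul_I_re]

theorem torusLift_mFourier_im (k : Fin 3 → ℤ) :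
    torusLift (fun x => (UnitAddTorus.mFourier k x).im) = fun X => Real.sin (phase k X) := by
  ext X
  simp only [torusLift, mFourier_toTorus, Complex.exp_ofReal_mul_I_im]

theorem contDiff_phase (k : Fin 3 → ℤ) : ContDiff ℝ ∞ (phase k) := by
  unfold phase
  fun_prop

theorem contDiff_torusLift_mFourier_re (k : Fin 3 → ℤ) :
    ContDiff ℝ ∞ (torusLift fun x => (UnitAddTorus.mFourier k x).re) := by
  rw [torusLift_mFourier_re]
  exact Real.contDiff_cos.comp (contDiff_phase k)

theorem contDiff_torusLift_mFourier_im (k : Fin 3 → ℤ) :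
    ContDiff ℝ ∞ (torusLift fun x => (UnitAddTorus.mFourier k x).im) := by
  rw [torusLift_mFourier_im]
  exact Real.contDiff_sin.comp (contDiff_phase k)

theorem contDiff_torusLift_cas (k : Fin 3 → ℤ) : ContDiff ℝ ∞ (torusLift (cas k)) :=
  (contDiff_torusLift_mFourier_re k).add (contDiff_torusLift_mFourier_im k)

theorem hasDerivAt_phase (k : Fin 3 → ℤ) (X : R3) (j : Fin 3) (t : ℝ) :
    HasDerivAt (fun t : ℝ => phase k (X + t • EuclideanSpace.single j 1)) (2 * Real.pi * k j) t := by
  have h : ∀ t : ℝ, phase k (X + t • EuclideanSpace.single j 1)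
      = phase k X + t * (2 * Real.pi * k j) := by
    intro t
    simp [phase, mul_add, Finset.sum_add_distrib]
    ring
  simp_rw [h]
  simpa using ((hasDerivAt_id t).mul_const (2 * Real.pi * (k j : ℝ))).const_add (phase k X)

theorem torusDeriv_mFourier_re (k : Fin 3 → ℤ) (j : Fin 3) :
    torusDeriv j (fun x => (UnitAddTorus.mFourier k x).re)
      = fun x => -(2 * Real.pi * k j) * (UnitAddTorus.mFourier k x).im := by
  ext x
  obtain ⟨X, rfl⟩ := isOpenQuotientMap_toTorus.surjective x
  rw [torusDeriv]
  simp only [toTorus_add_single, mFourier_toTorus, Complex.exp_ofReal_mul_I_re,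
    Complex.exp_ofReal_mul_I_im]
  rw [(hasDerivAt_phase k X j 0).cos.deriv]
  simp
  ring

theorem torusDeriv_mFourier_im (k : Fin 3 → ℤ) (j : Fin 3) :
    torusDeriv j (fun x => (UnitAddTorus.mFourier k x).im)
      = fun x => (2 * Real.pi * k j) * (UnitAddTorus.mFourier k x).re := by
  ext x
  obtain ⟨X, rfl⟩ := isOpenQuotientMap_toTorus.surjective x
  rw [torusDeriv]
  simp only [toTorus_add_single, mFourier_toTorus, Complex.exp_ofReal_mul_I_re,
    Complex.exp_ofReal_mul_I_im]
  rw [(hasDerivAt_phase k X j 0).sin.deriv]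
  simp
  ring

theorem torusDeriv_linearCombination {f g : Torus3 → ℝ} (hf : Differentiable ℝ (torusLift f))
    (hg : Differentiable ℝ (torusLift g)) (a b : ℝ) (j : Fin 3) :
    torusDeriv j (fun x => a * f x + b * g x)
      = fun x => a * torusDeriv j f x + b * torusDeriv j g x := by
  ext x
  simpa [torusDeriv] using (((hasDerivAt_torus hf x j 0).const_mul a).fun_add
    ((hasDerivAt_torus hg x j 0).const_mul b)).deriv

theorem torusDeriv_trig (k : Fin 3 → ℤ) (a b : ℝ) (j : Fin 3) :
    torusDeriv j (fun x => a * (UnitAddTorus.mFourier k x).re + b * (UnitAddTorus.mFourier k x).im)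
      = fun x => (2 * Real.pi * k j * b) * (UnitAddTorus.mFourier k x).re
        + (-(2 * Real.pi * k j * a)) * (UnitAddTorus.mFourier k x).im := by
  rw [torusDeriv_linearCombination
    ((contDiff_torusLift_mFourier_re k).differentiable (by simp))
    ((contDiff_torusLift_mFourier_im k).differentiable (by simp)), torusDeriv_mFourier_re,
    torusDeriv_mFourier_im]
  ext x
  ring

theorem cas_eq (k : Fin 3 → ℤ) : cas k = fun x =>
    1 * (UnitAddTorus.mFourier k x).re + 1 * (UnitAddTorus.mFourier k x).im := by
  ext x
  simp [cas]

theorem torusDeriv_im_sub_re (k : Fin 3 → ℤ) (j : Fin 3) :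
    torusDeriv j (fun x => (-1) * (UnitAddTorus.mFourier k x).re
      + 1 * (UnitAddTorus.mFourier k x).im) = fun x => 2 * Real.pi * k j * cas k x := by
  rw [torusDeriv_trig]
  ext x
  rw [cas]
  ring

theorem torusLaplacian_cas (k : Fin 3 → ℤ) :
    torusLaplacian (cas k) = fun x => -(4 * Real.pi ^ 2 * ∑ i, (k i : ℝ) ^ 2) * cas k x := by
  ext x
  have h : ∀ j, torusDeriv j (torusDeriv j (cas k)) x
      = -(4 * Real.pi ^ 2 * (k j : ℝ) ^ 2) * cas k x := by
    intro j
    rw [cas_eq, torusDeriv_trig, torusDeriv_trig]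
    ring
  rw [torusLaplacian, Finset.mul_sum, ← Finset.sum_neg_distrib, Finset.sum_mul]
  exact Finset.sum_congr rfl fun j _ => h j

/-- If `k j ≠ 0`, the cosine and the sine are nonzero multiples of each other's `j`-th derivative,
and derivatives integrate to zero. -/
theorem integral_mFourier (k : Fin 3 → ℤ) :
    ∫ x, (UnitAddTorus.mFourier k x).re ∂torusMeasure = (if k = 0 then 1 else 0) ∧
      ∫ x, (UnitAddTorus.mFourier k x).im ∂torusMeasure = 0 := by
  by_cases hk : k = 0
  · simp [hk, UnitAddTorus.mFourier_zero]
  · obtain ⟨j, hj⟩ : ∃ j, k j ≠ 0 := by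
      by_contra! h
      exact hk (funext h)
    have hj' : (2 * Real.pi * (k j : ℝ)) ≠ 0 := by
      have : (k j : ℝ) ≠ 0 := by exact_mod_cast hj
      positivity
    have h1 := integral_torusDeriv_eq_zero (contDiff_torusLift_mFourier_im k) j
    have h2 := integral_torusDeriv_eq_zero (contDiff_torusLift_mFourier_re k) j
    rw [torusDeriv_mFourier_im, integral_const_mul] at h1
    rw [torusDeriv_mFourier_re, integral_const_mul] at h2
    rw [if_neg hk]
    exact ⟨(mul_eq_zero.1 h1).resolve_left hj',
      (mul_eq_zero.1 h2).resolve_left (neg_ne_zero.2 hj')⟩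

theorem cas_mul_cas (k l : Fin 3 → ℤ) (x : Torus3) :
    cas k x * cas l x = (UnitAddTorus.mFourier (k - l) x).re
      + (UnitAddTorus.mFourier (k + l) x).im := by
  rw [sub_eq_add_neg, UnitAddTorus.mFourier_add, UnitAddTorus.mFourier_add,
    UnitAddTorus.mFourier_neg]
  simp only [cas, Complex.mul_re, Complex.mul_im, Complex.conj_re, Complex.conj_im]
  ring

/-- In the product formula the sine term integrates to zero at every frequency, which makes `k` and
`-k` orthogonal and the normalisation one. -/
theorem integral_cas_mul_cas (k l : Fin 3 → ℤ) :
    ∫ x, cas k x * cas l x ∂torusMeasure = if k = l then 1 else 0 := by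
  simp_rw [cas_mul_cas]
  rw [integral_add
    (integrable_of_continuous_torus (contDiff_torusLift_mFourier_re _).continuous_of_torusLift)
    (integrable_of_continuous_torus (contDiff_torusLift_mFourier_im _).continuous_of_torusLift),
    (integral_mFourier _).1, (integral_mFourier _).2, add_zero]
  simp only [sub_eq_zero]

theorem mFourier_re_eq (k : Fin 3 → ℤ) (x : Torus3) :
    (UnitAddTorus.mFourier k x).re = (1 / 2) * (cas k x + cas (-k) x) := by
  simp only [cas, UnitAddTorus.mFourier_neg, Complex.conj_re, Complex.conj_im]
  ring

theorem mFourier_im_eq (k : Fin 3 → ℤ) (x : Torus3) :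
    (UnitAddTorus.mFourier k x).im = (1 / 2) * (cas k x - cas (-k) x) := by
  simp only [cas, UnitAddTorus.mFourier_neg, Complex.conj_re, Complex.conj_im]
  ring

/-! ### Stokes modes -/

/-- The frequency `k ∈ ℤ³` as a vector of `ℝ³`. -/
def freqVec (k : Fin 3 → ℤ) : R3 := WithLp.toLp 2 fun i => (k i : ℝ)

/-- The eigenvalue `4π²|k|²` of the Stokes operator. -/
def stokesEigenvalue (k : Fin 3 → ℤ) : ℝ := 4 * Real.pi ^ 2 * ∑ i, (k i : ℝ) ^ 2

/-- The orthogonal complement of the frequency `k` in `ℝ³`. -/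
abbrev freqPerp (k : Fin 3 → ℤ) : Submodule ℝ R3 := (ℝ ∙ freqVec k)ᗮ

theorem inner_freqVec (k : Fin 3 → ℤ) (u : R3) : ⟪freqVec k, u⟫ = ∑ i, u i * (k i : ℝ) := by
  simp [PiLp.inner_apply, freqVec]

theorem mem_freqPerp {k : Fin 3 → ℤ} {u : R3} : u ∈ freqPerp k ↔ ∑ i, u i * (k i : ℝ) = 0 := by
  rw [Submodule.mem_orthogonal_singleton_iff_inner_right, inner_freqVec]

/-- The vector field `u (cos(2πk·x) + sin(2πk·x))`. -/
def casField (k : Fin 3 → ℤ) (u : R3) (x : Torus3) : R3 := cas k x • u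

theorem contDiff_casField (k : Fin 3 → ℤ) (u : R3) : ContDiff ℝ ∞ (periodicLift (casField k u)) :=
  (contDiff_torusLift_cas k).smul contDiff_const

theorem continuous_casField (k : Fin 3 → ℤ) (u : R3) : Continuous (casField k u) :=
  (contDiff_torusLift_cas k).continuous_of_torusLift.smul continuous_const

theorem isSmoothSolenoidal_casField {k : Fin 3 → ℤ} {u : R3} (hu : u ∈ freqPerp k) :
    IsSmoothSolenoidal (casField k u) := by
  refine ⟨contDiff_casField k u, fun X => ?_⟩
  have hd : Differentiable ℝ (torusLift (cas k)) :=
    (contDiff_torusLift_cas k).differentiable (by simp)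
  have h1 : periodicLift (casField k u) = fun X => torusLift (cas k) X • u := rfl
  have h2 : ∀ j, fderiv ℝ (torusLift (cas k)) X (EuclideanSpace.single j 1) =
      2 * Real.pi * k j * ((UnitAddTorus.mFourier k (toTorus X)).re
        - (UnitAddTorus.mFourier k (toTorus X)).im) := by
    intro j
    have h3 := congrFun (torusLift_torusDeriv hd j) X
    rw [← h3, torusLift, cas_eq, torusDeriv_trig]
    ring
  rw [divergence, h1, fderiv_smul_const (hd X)]
  simp only [ContinuousLinearMap.smulRight_apply, PiLp.smul_apply, smul_eq_mul, h2]
  have h4 := mem_freqPerp.1 hu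
  calc _ = 2 * Real.pi * ((UnitAddTorus.mFourier k (toTorus X)).re
        - (UnitAddTorus.mFourier k (toTorus X)).im) * ∑ i, u i * (k i : ℝ) := by
        rw [Finset.mul_sum]
        exact Finset.sum_congr rfl fun i _ => by ring
    _ = 0 := by rw [h4, mul_zero]

theorem memLp_of_continuous_torus {F : Type*} [NormedAddCommGroup F] {f : Torus3 → F}
    (hf : Continuous f) : MemLp f 2 torusMeasure :=
  hf.memLp_of_hasCompactSupport (HasCompactSupport.of_compactSpace f)

/-- The class in `L²` of the field `u (cos(2πk·x) + sin(2πk·x))`, as a linear function of `u`. -/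
def casLp (k : Fin 3 → ℤ) : R3 →ₗ[ℝ] L2Field where
  toFun u := (memLp_of_continuous_torus (continuous_casField k u)).toLp (casField k u)
  map_add' u v := by
    rw [← MemLp.toLp_add]
    congr 1
    ext x : 1
    exact smul_add _ _ _
  map_smul' c u := by
    rw [RingHom.id_apply, ← MemLp.toLp_const_smul]
    congr 1
    ext x : 1
    exact smul_comm _ _ _

theorem coeFn_casLp (k : Fin 3 → ℤ) (u : R3) : casLp k u =ᵐ[torusMeasure] casField k u :=
  (memLp_of_continuous_torus (continuous_casField k u)).coeFn_toLp

theorem inner_casLp_left {k : Fin 3 → ℤ} {u : R3} {f : L2Field} {φ : Torus3 → R3}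
    (hf : f =ᵐ[torusMeasure] φ) :
    ⟪casLp k u, f⟫ = ∫ x, cas k x * ⟪u, φ x⟫ ∂torusMeasure := by
  rw [L2.inner_def]
  refine integral_congr_ae ?_
  filter_upwards [coeFn_casLp k u, hf] with x h1 h2
  rw [h1, h2, casField, real_inner_smul_left]

theorem inner_casLp_casLp (k l : Fin 3 → ℤ) (u v : R3) :
    ⟪casLp k u, casLp l v⟫ = if k = l then ⟪u, v⟫ else 0 := by
  rw [inner_casLp_left (coeFn_casLp l v)]
  simp_rw [casField, real_inner_smul_right, ← mul_assoc]
  rw [integral_mul_const, integral_cas_mul_cas]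
  split_ifs <;> simp

theorem casLp_mem_solenoidalSubmodule {k : Fin 3 → ℤ} {u : R3} (hu : u ∈ freqPerp k) :
    casLp k u ∈ solenoidalSubmodule :=
  Submodule.le_topologicalClosure _ (Submodule.subset_span
    ⟨casField k u, isSmoothSolenoidal_casField hu, coeFn_casLp k u⟩)

/-- The element `u (cos(2πk·x) + sin(2πk·x))` of `H`, for `u ⟂ k`. -/
def casMode (k : Fin 3 → ℤ) (u : freqPerp k) : SolenoidalSpace :=
  ⟨casLp k u, casLp_mem_solenoidalSubmodule u.2⟩

theorem contDiff_torusLift_inner {φ : Torus3 → R3} (hφ : ContDiff ℝ ∞ (periodicLift φ)) (u : R3) :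
    ContDiff ℝ ∞ (torusLift fun x => ⟪u, φ x⟫) :=
  (innerSL ℝ u).contDiff.comp hφ

theorem inner_eq_neg_torusLaplacian {φ ψ : Torus3 → R3} (hφ : ContDiff ℝ ∞ (periodicLift φ))
    (hψ : periodicLift ψ = -Laplacian.laplacian (periodicLift φ)) (u : R3) (x : Torus3) :
    ⟪u, ψ x⟫ = -torusLaplacian (fun x => ⟪u, φ x⟫) x := by
  obtain ⟨X, rfl⟩ := isOpenQuotientMap_toTorus.surjective x
  have h1 : ψ (toTorus X) = -Laplacian.laplacian (periodicLift φ) X := congrFun hψ X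
  have h2 := (hφ.contDiffAt (x := X)).of_le (m := 2) (WithTop.coe_le_coe.2 le_top)
  have h3 := h2.laplacian_CLM_comp_left (l := innerSL ℝ u)
  have h4 := congrFun (laplacian_torusLift (contDiff_torusLift_inner hφ u)) X
  have h5 : (innerSL ℝ u ∘ periodicLift φ) = torusLift fun x => ⟪u, φ x⟫ := rfl
  rw [h5, h4] at h3
  change torusLaplacian _ (toTorus X) = ⟪u, _⟫ at h3
  rw [h1, inner_neg_right, h3]

/-- Green's identity moves the Laplacian from the test field to `cas k`. -/
theorem casMode_mem_stokesEigenspace (k : Fin 3 → ℤ) (u : freqPerp k) :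
    casMode k u ∈ stokesEigenspace (stokesEigenvalue k) := by
  intro φ ψ hφ hψ p q hp hq
  change ⟪casLp k u, q⟫ = _ * ⟪casLp k u, p⟫
  rw [inner_casLp_left hp, inner_casLp_left hq]
  simp_rw [inner_eq_neg_torusLaplacian hφ.smooth hψ]
  have h := integral_torusLaplacian_mul (contDiff_torusLift_cas k)
    (contDiff_torusLift_inner hφ.smooth (u : R3))
  simp_rw [mul_neg]
  rw [integral_neg, ← h, ← integral_const_mul, ← integral_neg, torusLaplacian_cas]
  refine integral_congr_ae (ae_of_all _ fun x => ?_)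
  simp only [stokesEigenvalue]
  ring

theorem laplacian_casField (k : Fin 3 → ℤ) (u : R3) :
    periodicLift (fun x => stokesEigenvalue k • casField k u x)
      = -Laplacian.laplacian (periodicLift (casField k u)) := by
  ext1 X
  have h2 := ((contDiff_torusLift_cas k).contDiffAt (x := X)).of_le (m := 2)
    (WithTop.coe_le_coe.2 le_top)
  have h3 := h2.laplacian_CLM_comp_left (l := ContinuousLinearMap.toSpanSingleton ℝ u)
  have h5 : (ContinuousLinearMap.toSpanSingleton ℝ u ∘ torusLift (cas k))
    = periodicLift (casField k u) := rfl
  rw [h5] at h3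
  rw [Pi.neg_apply, h3, Function.comp_apply, laplacian_torusLift (contDiff_torusLift_cas k)]
  change stokesEigenvalue k • cas k (toTorus X) • u = -(torusLaplacian (cas k) (toTorus X) • u)
  rw [torusLaplacian_cas, smul_smul, ← neg_smul, stokesEigenvalue]
  congr 1
  ring

/-- The mode is itself an admissible test field in the weak eigenvalue equation, so the difference
of the eigenvalues times the inner product vanishes. -/
theorem casMode_mem_orthogonal_stokesEigenspace {k : Fin 3 → ℤ} (u : freqPerp k) {lam : ℝ}
    (h : stokesEigenvalue k ≠ lam) : casMode k u ∈ (stokesEigenspace lam)ᗮ := by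
  rw [Submodule.mem_orthogonal]
  intro f hf
  change ⟪(f : L2Field), casLp k u⟫ = 0
  have hq : (stokesEigenvalue k • casLp k u : L2Field) =ᵐ[torusMeasure]
      fun x => stokesEigenvalue k • casField k u x := by
    filter_upwards [Lp.coeFn_smul (stokesEigenvalue k) (casLp k (u : R3)), coeFn_casLp k u]
      with x h1 h2
    rw [h1, Pi.smul_apply, h2]
  have h1 := hf _ _ (isSmoothSolenoidal_casField u.2) (laplacian_casField k u) _ _
    (coeFn_casLp k u) hq
  rw [real_inner_smul_right] at h1
  have h2 : (stokesEigenvalue k - lam) * ⟪(f : L2Field), casLp k u⟫ = 0 := by linarith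
  exact (mul_eq_zero.1 h2).resolve_left (sub_ne_zero.2 h)

/-! ### Galerkin spaces -/

theorem freqPerp_neg (k : Fin 3 → ℤ) : freqPerp (-k) = freqPerp k := by
  ext u
  simp [mem_freqPerp]

/-- The half-sum and half-difference of the modes at `k` and `-k` are the cosine and sine modes, and
they add up to the mode at `k`. -/
theorem casMode_mem_galerkinSpace {k : Fin 3 → ℤ} (u : freqPerp k) {m : ℕ}
    (h : ∑ i, k i ^ 2 ≤ (m : ℤ) ^ 2) : casMode k u ∈ galerkinSpace m := by
  set v : SolenoidalSpace := casMode (-k) ⟨u, by rw [freqPerp_neg]; exact u.2⟩ with hv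
  have hvL : (v : L2Field) = casLp (-k) (u : R3) := rfl
  have huL : (casMode k u : L2Field) = casLp k (u : R3) := rfl
  have hsub : galerkinSpace m = (Submodule.span ℝ {f | ∃ k : Fin 3 → ℤ, ∑ i, k i ^ 2 ≤ (m : ℤ) ^ 2 ∧
    IsStokesMode k f}).topologicalClosure := rfl
  have hcos : IsStokesMode k ((1 / 2 : ℝ) • (casMode k u + v)) := by
    refine ⟨u, mem_freqPerp.1 u.2, Or.inl ?_⟩
    rw [Submodule.coe_smul, Submodule.coe_add, huL, hvL]
    filter_upwards [Lp.coeFn_smul (1 / 2 : ℝ) (casLp k (u : R3) + casLp (-k) (u : R3)),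
      Lp.coeFn_add (casLp k (u : R3)) (casLp (-k) (u : R3)), coeFn_casLp k u, coeFn_casLp (-k) u]
      with x h1 h2 h3 h4
    rw [h1, Pi.smul_apply, h2, Pi.add_apply, h3, h4, mFourier_re_eq, casField, casField, ← add_smul,
      smul_smul]
  have hsin : IsStokesMode k ((1 / 2 : ℝ) • (casMode k u - v)) := by
    refine ⟨u, mem_freqPerp.1 u.2, Or.inr ?_⟩
    rw [Submodule.coe_smul, Submodule.coe_sub, huL, hvL]
    filter_upwards [Lp.coeFn_smul (1 / 2 : ℝ) (casLp k (u : R3) - casLp (-k) (u : R3)),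
      Lp.coeFn_sub (casLp k (u : R3)) (casLp (-k) (u : R3)), coeFn_casLp k u, coeFn_casLp (-k) u]
      with x h1 h2 h3 h4
    rw [h1, Pi.smul_apply, h2, Pi.sub_apply, h3, h4, mFourier_im_eq, casField, casField, ← sub_smul,
      smul_smul]
  have hsum : casMode k u = (1 / 2 : ℝ) • (casMode k u + v) + (1 / 2 : ℝ) • (casMode k u - v) := by
    module
  rw [hsum, hsub]
  refine Submodule.le_topologicalClosure _ (Submodule.add_mem _ (Submodule.subset_span ⟨k, h, hcos⟩)
    (Submodule.subset_span ⟨k, h, hsin⟩))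

theorem casMode_mem_orthogonal_galerkinSpace {k : Fin 3 → ℤ} (u : freqPerp k) {m : ℕ}
    (h : ¬ ∑ i, k i ^ 2 ≤ (m : ℤ) ^ 2) : casMode k u ∈ (galerkinSpace m)ᗮ := by
  have hsub : galerkinSpace m = (Submodule.span ℝ {f | ∃ k : Fin 3 → ℤ, ∑ i, k i ^ 2 ≤ (m : ℤ) ^ 2 ∧
    IsStokesMode k f}).topologicalClosure := rfl
  rw [hsub, Submodule.orthogonal_closure, Submodule.mem_orthogonal]
  intro f hf
  rw [real_inner_comm]
  have hle : Submodule.span ℝ {f | ∃ k : Fin 3 → ℤ, ∑ i, k i ^ 2 ≤ (m : ℤ) ^ 2 ∧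
      IsStokesMode k f} ≤ (ℝ ∙ casMode k u)ᗮ := by
    refine Submodule.span_le.2 ?_
    rintro g ⟨l, hl, w, hw, hg⟩
    refine Submodule.mem_orthogonal_singleton_iff_inner_right.2 ?_
    change ⟪casLp k u, (g : L2Field)⟫ = 0
    have hkl : k ≠ l := fun hkl => h (hkl ▸ hl)
    have hkl' : k ≠ -l := fun hkl => h (by simpa [hkl] using hl)
    have h0 : ∫ x, cas k x * cas l x ∂torusMeasure = 0 := by rw [integral_cas_mul_cas, if_neg hkl]
    have h0' : ∫ x, cas k x * cas (-l) x ∂torusMeasure = 0 := by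
      rw [integral_cas_mul_cas, if_neg hkl']
    have hint : ∀ n, Integrable (fun x => cas k x * cas n x) torusMeasure := fun n =>
      integrable_of_continuous_torus ((contDiff_torusLift_cas k).continuous_of_torusLift.fun_mul
        (contDiff_torusLift_cas n).continuous_of_torusLift)
    rcases hg with hg | hg
    · rw [inner_casLp_left hg]
      have h1 : ∀ x, cas k x * ⟪(u : R3), (UnitAddTorus.mFourier l x).re • w⟫
          = (1 / 2 * ⟪(u : R3), w⟫) * (cas k x * cas l x + cas k x * cas (-l) x) := by
        intro x
        rw [real_inner_smul_right, mFourier_re_eq]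
        ring
      simp_rw [h1]
      rw [integral_const_mul, integral_add (hint _) (hint _), h0, h0']
      simp
    · rw [inner_casLp_left hg]
      have h1 : ∀ x, cas k x * ⟪(u : R3), (UnitAddTorus.mFourier l x).im • w⟫
          = (1 / 2 * ⟪(u : R3), w⟫) * (cas k x * cas l x - cas k x * cas (-l) x) := by
        intro x
        rw [real_inner_smul_right, mFourier_im_eq]
        ring
      simp_rw [h1]
      rw [integral_const_mul, integral_sub (hint _) (hint _), h0, h0']
      simp
  exact Submodule.mem_orthogonal_singleton_iff_inner_right.1 (hle hf)

/-! ### Completeness of the modes -/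

theorem sum_torusDeriv_eq_zero {φ : Torus3 → R3} (hφ : IsSmoothSolenoidal φ) (x : Torus3) :
    ∑ j, torusDeriv j (fun x => φ x j) x = 0 := by
  obtain ⟨X, rfl⟩ := isOpenQuotientMap_toTorus.surjective x
  rw [← hφ.div_eq_zero X, divergence]
  refine Finset.sum_congr rfl fun j _ => ?_
  have hd : Differentiable ℝ (periodicLift φ) := hφ.smooth.differentiable (by simp)
  have h1 : HasFDerivAt (torusLift fun x => φ x j)
      ((EuclideanSpace.proj j : R3 →L[ℝ] ℝ).comp (fderiv ℝ (periodicLift φ) X)) X :=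
    (EuclideanSpace.proj j : R3 →L[ℝ] ℝ).hasFDerivAt.comp X (hd X).hasFDerivAt
  have h2 : Differentiable ℝ (torusLift fun x => φ x j) :=
    (EuclideanSpace.proj j : R3 →L[ℝ] ℝ).differentiable.comp hd
  have h3 := congrFun (torusLift_torusDeriv h2 j) X
  dsimp only at h3
  rw [h1.fderiv] at h3
  exact h3

/-- The gradient of sin − cos is `2πk · cas k`, so this is `div φ = 0` integrated by parts against
sin − cos. -/
theorem integral_cas_mul_inner_freqVec {φ : Torus3 → R3} (hφ : IsSmoothSolenoidal φ)
    (k : Fin 3 → ℤ) : ∫ x, cas k x * ⟪freqVec k, φ x⟫ ∂torusMeasure = 0 := by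
  have hφj : ∀ j, ContDiff ℝ ∞ (torusLift fun x => φ x j) := fun j =>
    (EuclideanSpace.proj j : R3 →L[ℝ] ℝ).contDiff.comp hφ.smooth
  set S : Torus3 → ℝ := fun x => (-1) * (UnitAddTorus.mFourier k x).re
    + 1 * (UnitAddTorus.mFourier k x).im with hS
  have hSc : ContDiff ℝ ∞ (torusLift S) :=
    (contDiff_const.mul (contDiff_torusLift_mFourier_re k)).add
      (contDiff_const.mul (contDiff_torusLift_mFourier_im k))
  have hScont : Continuous S := hSc.continuous_of_torusLift
  have h1 : ∀ j, ∫ x, torusDeriv j (fun x => φ x j) x * S x ∂torusMeasure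
      = -∫ x, φ x j * (2 * Real.pi * k j * cas k x) ∂torusMeasure := by
    intro j
    rw [integral_torusDeriv_mul (hφj j) hSc, hS, torusDeriv_im_sub_re]
  have hc1 : ∀ j, Continuous fun x => φ x j := fun j => (hφj j).continuous_of_torusLift
  have hc2 : ∀ j, Continuous (torusDeriv j fun x => φ x j) := fun j =>
    ((hφj j).torusLift_torusDeriv j).continuous_of_torusLift
  have hc3 : Continuous (cas k) := (contDiff_torusLift_cas k).continuous_of_torusLift
  have h2 : ∑ j, ∫ x, torusDeriv j (fun x => φ x j) x * S x ∂torusMeasure = 0 := by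
    rw [← integral_finsetSum _ fun j _ =>
      integrable_of_continuous_torus ((hc2 j).fun_mul hScont)]
    simp_rw [← Finset.sum_mul, sum_torusDeriv_eq_zero hφ]
    simp
  simp_rw [h1] at h2
  rw [Finset.sum_neg_distrib, neg_eq_zero, ← integral_finsetSum _ fun j _ =>
    integrable_of_continuous_torus ((hc1 j).fun_mul (continuous_const.fun_mul hc3))] at h2
  have h3 : ∀ x, ∑ j, φ x j * (2 * Real.pi * k j * cas k x)
      = (2 * Real.pi) * (cas k x * ⟪freqVec k, φ x⟫) := by
    intro x
    rw [inner_freqVec, Finset.mul_sum, Finset.mul_sum]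
    exact Finset.sum_congr rfl fun j _ => by ring
  simp_rw [h3] at h2
  rw [integral_const_mul] at h2
  exact (mul_eq_zero.1 h2).resolve_left (by positivity)

theorem inner_casLp_freqVec_eq_zero {f : L2Field} (hf : f ∈ solenoidalSubmodule) (k : Fin 3 → ℤ) :
    ⟪casLp k (freqVec k), f⟫ = 0 := by
  have hle : solenoidalSubmodule ≤ (ℝ ∙ casLp k (freqVec k))ᗮ := by
    refine Submodule.topologicalClosure_minimal _ (Submodule.span_le.2 ?_)
      (Submodule.isClosed_orthogonal _)
    rintro g ⟨φ, hφ, hg⟩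
    refine Submodule.mem_orthogonal_singleton_iff_inner_right.2 ?_
    rw [inner_casLp_left hg, integral_cas_mul_inner_freqVec hφ]
  exact Submodule.mem_orthogonal_singleton_iff_inner_right.1 (hle hf)

theorem eq_zero_of_mFourierCoeff_eq_zero (G : Lp ℂ 2 torusMeasure)
    (h : ∀ n : Fin 3 → ℤ, ∫ t, UnitAddTorus.mFourier (-n) t • G t ∂torusMeasure = 0) : G = 0 := by
  apply (UnitAddTorus.mFourierBasis (d := Fin 3)).repr.injective
  ext n
  rw [UnitAddTorus.mFourierBasis_repr, map_zero]
  exact h n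

/-- Real and imaginary parts of each exponential are combinations of `cas n` and `cas (-n)`, so
every complex Fourier coefficient of every component vanishes. -/
theorem eq_zero_of_inner_casLp_eq_zero {f : L2Field} (hf : ∀ k u, ⟪casLp k u, f⟫ = 0) : f = 0 := by
  have hcomp : ∀ j : Fin 3, ∀ᵐ x ∂torusMeasure, f x j = 0 := by
    intro j
    set L : R3 →L[ℝ] ℂ := Complex.ofRealCLM.comp (EuclideanSpace.proj j : R3 →L[ℝ] ℝ) with hL
    have hcoe := L.coeFn_compLp f
    have hmem : MemLp (fun x => f x j) 2 torusMeasure :=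
      (EuclideanSpace.proj j : R3 →L[ℝ] ℝ).comp_memLp' (Lp.memLp f)
    have hcas : ∀ k, ∫ x, cas k x * f x j ∂torusMeasure = 0 := by
      intro k
      rw [← hf k (EuclideanSpace.single j 1), inner_casLp_left (ae_eq_refl _)]
      simp [EuclideanSpace.inner_single_left]
    have hint : ∀ k, Integrable (fun x => cas k x * f x j) torusMeasure := fun k =>
      (hmem.integrable (by norm_num)).bdd_mul
        (contDiff_torusLift_cas k).continuous_of_torusLift.aestronglyMeasurable
        (c := 2) (ae_of_all _ fun x => by
          obtain ⟨X, rfl⟩ := isOpenQuotientMap_toTorus.surjective x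
          rw [cas, mFourier_toTorus, Complex.exp_ofReal_mul_I_re, Complex.exp_ofReal_mul_I_im,
            Real.norm_eq_abs]
          have h1 := abs_add_le (Real.cos (phase k X)) (Real.sin (phase k X))
          have h2 := Real.abs_cos_le_one (phase k X)
          have h3 := Real.abs_sin_le_one (phase k X)
          linarith)
    have hzero : L.compLp f = 0 := by
      refine eq_zero_of_mFourierCoeff_eq_zero _ fun n => ?_
      have h1 : (fun t => UnitAddTorus.mFourier (-n) t • (L.compLp f) t) =ᵐ[torusMeasure]
          fun t => (((1 / 2 * (cas (-n) t * f t j + cas n t * f t j) : ℝ)) : ℂ)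
            + (((1 / 2 * (cas (-n) t * f t j - cas n t * f t j) : ℝ)) : ℂ) * Complex.I := by
        filter_upwards [hcoe] with t ht
        rw [ht, smul_eq_mul, ← Complex.re_add_im (UnitAddTorus.mFourier (-n) t), mFourier_re_eq,
          mFourier_im_eq, neg_neg]
        simp [hL]
        ring
      have i1 : Integrable (fun t => 1 / 2 * (cas (-n) t * f t j + cas n t * f t j)) torusMeasure :=
        ((hint (-n)).fun_add (hint n)).const_mul _
      have i2 : Integrable (fun t => 1 / 2 * (cas (-n) t * f t j - cas n t * f t j)) torusMeasure :=
        ((hint (-n)).sub (hint n)).const_mul _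
      rw [integral_congr_ae h1, integral_add i1.ofReal (i2.ofReal.mul_const _), integral_mul_const,
        integral_complex_ofReal, integral_complex_ofReal, integral_const_mul, integral_const_mul,
        integral_add (hint _) (hint _), integral_sub (hint _) (hint _), hcas, hcas]
      simp
    rw [hzero] at hcoe
    filter_upwards [hcoe, Lp.coeFn_zero ℂ 2 torusMeasure] with x h1 h2
    rw [h2] at h1
    have h3 : ((f x j : ℝ) : ℂ) = 0 := h1.symm
    exact_mod_cast h3
  rw [Lp.eq_zero_iff_ae_eq_zero]
  filter_upwards [ae_all_iff.2 hcomp] with x hx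
  ext j
  exact hx j

/-- The index set of the orthonormal basis of Stokes modes. -/
abbrev ModeIndex : Type := Σ k : Fin 3 → ℤ, Fin (Module.finrank ℝ (freqPerp k))

/-- The orthonormal modes `u (cos(2πk·x) + sin(2πk·x))`, where `u` runs through an orthonormal basis
of the orthogonal complement of `k`. -/
def modeVector (i : ModeIndex) : SolenoidalSpace :=
  casMode i.1 (stdOrthonormalBasis ℝ (freqPerp i.1) i.2)

theorem orthonormal_modeVector : Orthonormal ℝ modeVector := by
  rw [orthonormal_iff_ite]
  rintro ⟨k, a⟩ ⟨l, c⟩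
  change ⟪casLp k _, casLp l _⟫ = _
  rw [inner_casLp_casLp]
  by_cases hkl : k = l
  · subst hkl
    rw [if_pos rfl]
    have h := orthonormal_iff_ite.1 (stdOrthonormalBasis ℝ (freqPerp k)).orthonormal a c
    rw [Submodule.coe_inner] at h
    rw [h]
    simp
  · rw [if_neg hkl, if_neg fun h => hkl (congrArg Sigma.fst h)]

/-- Split the amplitude along `k` and `k⟂`: the first part is orthogonal to all of `H` by
incompressibility, the second is spanned by modes. At `k = 0` the first part is trivial. -/
theorem orthogonal_span_modeVector : (Submodule.span ℝ (Set.range modeVector))ᗮ = ⊥ := by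
  rw [Submodule.eq_bot_iff]
  intro f hf
  have hmode : ∀ i, ⟪(modeVector i : L2Field), (f : L2Field)⟫ = 0 := fun i =>
    (Submodule.mem_orthogonal _ _).1 hf _ (Submodule.subset_span ⟨i, rfl⟩)
  suffices h : (f : L2Field) = 0 from Subtype.ext h
  refine eq_zero_of_inner_casLp_eq_zero fun k u => ?_
  set ℓ : R3 →ₗ[ℝ] ℝ := (innerₛₗ ℝ (f : L2Field)).comp (casLp k) with hℓ
  have hker : ⊤ ≤ LinearMap.ker ℓ := by
    rw [← Submodule.sup_orthogonal_of_hasOrthogonalProjection (K := ℝ ∙ freqVec k)]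
    refine sup_le ?_ ?_
    · rw [Submodule.span_singleton_le_iff_mem, LinearMap.mem_ker]
      change ⟪(f : L2Field), casLp k (freqVec k)⟫ = 0
      rw [real_inner_comm, inner_casLp_freqVec_eq_zero f.2]
    · have h0 : ℓ.comp (freqPerp k).subtype = 0 := by
        refine (stdOrthonormalBasis ℝ (freqPerp k)).toBasis.ext fun a => ?_
        have := hmode ⟨k, a⟩
        rw [real_inner_comm] at this
        rw [OrthonormalBasis.coe_toBasis]
        exact this
      intro w hw
      exact LinearMap.congr_fun h0 ⟨w, hw⟩
  have h1 : ℓ u = 0 := hker (Submodule.mem_top (x := u))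
  rw [real_inner_comm]
  exact h1

/-- The Hilbert basis of `H` consisting of eigenvectors of the Stokes operator. -/
def modeBasis : HilbertBasis ModeIndex ℝ SolenoidalSpace :=
  HilbertBasis.mkOfOrthogonalEqBot orthonormal_modeVector orthogonal_span_modeVector

theorem modeBasis_apply (i : ModeIndex) : modeBasis i = modeVector i := by
  rw [modeBasis, HilbertBasis.coe_mkOfOrthogonalEqBot]

/-! ### Diagonalisation of the operators -/

theorem starProjection_stokesEigenspace_modeBasis (lam : ℝ) (i : ModeIndex) :
    (stokesEigenspace lam).starProjection (modeBasis i)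
      = if stokesEigenvalue i.1 = lam then modeBasis i else 0 := by
  rw [modeBasis_apply]
  split_ifs with h
  · rw [Submodule.starProjection_eq_self_iff, ← h]
    exact casMode_mem_stokesEigenspace _ _
  · rw [Submodule.starProjection_apply_eq_zero_iff]
    exact casMode_mem_orthogonal_stokesEigenspace _ h

theorem galerkinProjection_modeBasis (m : ℕ) (i : ModeIndex) :
    galerkinProjection m (modeBasis i)
      = if ∑ j, i.1 j ^ 2 ≤ (m : ℤ) ^ 2 then modeBasis i else 0 := by
  rw [modeBasis_apply, galerkinProjection]
  split_ifs with h
  · rw [Submodule.starProjection_eq_self_iff]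
    exact casMode_mem_galerkinSpace _ h
  · rw [Submodule.starProjection_apply_eq_zero_iff]
    exact casMode_mem_orthogonal_galerkinSpace _ h

theorem inner_galerkinProjection (m : ℕ) (i : ModeIndex) (v : SolenoidalSpace) :
    ⟪modeBasis i, galerkinProjection m v⟫
      = (if ∑ j, i.1 j ^ 2 ≤ (m : ℤ) ^ 2 then 1 else 0) * ⟪modeBasis i, v⟫ := by
  have h1 : ⟪modeBasis i, galerkinProjection m v⟫ = ⟪galerkinProjection m (modeBasis i), v⟫ :=
    (Submodule.inner_starProjection_left_eq_right _ _ _).symm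
  rw [h1, galerkinProjection_modeBasis]
  split_ifs <;> simp

/-- Boundedness of `F` on the spectrum makes the series over modes converge. Grouping it by
eigenvalue gives the sum over all real `lam` that defines `stokesCalculus`, and shows that it really
converges instead of taking the default value of `tsum`. -/
theorem inner_stokesCalculus {F : ℝ → ℝ} {C : ℝ} (hF : ∀ k, |F (stokesEigenvalue k)| ≤ C)
    (i : ModeIndex) (v : SolenoidalSpace) :
    ⟪modeBasis i, stokesCalculus F v⟫ = F (stokesEigenvalue i.1) * ⟪modeBasis i, v⟫ := by
  set c : ModeIndex → ℝ := fun i => F (stokesEigenvalue i.1) * ⟪modeBasis i, v⟫ with hc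
  have hsq : Summable fun i => c i ^ 2 := by
    refine Summable.of_nonneg_of_le (fun i => sq_nonneg _) (fun i => ?_)
      ((modeBasis.hasSum_sq_inner v).summable.mul_left (C ^ 2))
    rw [hc, mul_pow]
    refine mul_le_mul_of_nonneg_right ?_ (sq_nonneg _)
    rw [← sq_abs]
    exact pow_le_pow_left₀ (abs_nonneg _) (hF _) 2
  have hsum := (hasSum_basisSeries modeBasis hsq).tsum_fiberwise
    fun i : ModeIndex => stokesEigenvalue i.1
  have hfib : ∀ lam : ℝ, ∑' i : (fun i : ModeIndex => stokesEigenvalue i.1) ⁻¹' {lam},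
      c i • modeBasis i = F lam • (stokesEigenspace lam).starProjection v := by
    intro lam
    have h1 := ((modeBasis.hasSum_repr v).mapL (stokesEigenspace lam).starProjection).const_smul
      (F lam)
    have h2 : HasSum (((fun i : ModeIndex => stokesEigenvalue i.1) ⁻¹' {lam}).indicator
        fun i => c i • modeBasis i) (F lam • (stokesEigenspace lam).starProjection v) := by
      refine h1.congr_fun fun i => ?_
      rw [map_smul, starProjection_stokesEigenspace_modeBasis, modeBasis.repr_apply_apply]
      by_cases h : stokesEigenvalue i.1 = lam
      · rw [Set.indicator_of_mem (by exact h), if_pos h, smul_smul, ← h]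
      · rw [Set.indicator_of_notMem (by exact h), if_neg h, smul_zero, smul_zero]
    exact (hasSum_subtype_iff_indicator.2 h2).tsum_eq
  simp_rw [hfib] at hsum
  rw [stokesCalculus, hsum.tsum_eq, inner_basisSeries modeBasis hsq]

/-! ### Eigenvalues of the covariance operators -/

/-- The eigenvalue of `(I + δ A^{2β})⁻¹` at the frequency `k`. -/
def regularisationSymbol (β δ : ℝ) (k : Fin 3 → ℤ) : ℝ := (1 + δ * stokesEigenvalue k ^ (2 * β))⁻¹

/-- The indicator function of the frequencies `|k| ≤ m`. -/
def galerkinSymbol (m : ℕ) (k : Fin 3 → ℤ) : ℝ := if ∑ j, k j ^ 2 ≤ (m : ℤ) ^ 2 then 1 else 0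

theorem norm_freqVec_sq (k : Fin 3 → ℤ) : ‖freqVec k‖ ^ 2 = ∑ i, (k i : ℝ) ^ 2 := by
  rw [EuclideanSpace.norm_sq_eq]
  simp [freqVec]

theorem stokesEigenvalue_eq (k : Fin 3 → ℤ) :
    stokesEigenvalue k = 4 * Real.pi ^ 2 * ‖freqVec k‖ ^ 2 := by
  rw [norm_freqVec_sq, stokesEigenvalue]

theorem stokesEigenvalue_nonneg (k : Fin 3 → ℤ) : 0 ≤ stokesEigenvalue k := by
  rw [stokesEigenvalue_eq]; positivity

theorem norm_freqVec_pos {k : Fin 3 → ℤ} (hk : k ≠ 0) : 0 < ‖freqVec k‖ := by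
  rw [norm_pos_iff]
  intro h
  refine hk (funext fun i => ?_)
  have : (freqVec k) i = 0 := by rw [h]; rfl
  exact_mod_cast (show (k i : ℝ) = 0 from this)

theorem one_le_regularisation_denominator {δ : ℝ} (β : ℝ) (hδ : 0 ≤ δ) (k : Fin 3 → ℤ) :
    1 ≤ 1 + δ * stokesEigenvalue k ^ (2 * β) :=
  le_add_of_nonneg_right (mul_nonneg hδ (Real.rpow_nonneg (stokesEigenvalue_nonneg k) _))

theorem regularisationSymbol_nonneg {δ : ℝ} (β : ℝ) (hδ : 0 ≤ δ) (k : Fin 3 → ℤ) :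
    0 ≤ regularisationSymbol β δ k :=
  inv_nonneg.2 (zero_le_one.trans (one_le_regularisation_denominator β hδ k))

theorem regularisationSymbol_le_one {δ : ℝ} (β : ℝ) (hδ : 0 ≤ δ) (k : Fin 3 → ℤ) :
    regularisationSymbol β δ k ≤ 1 :=
  inv_le_one_of_one_le₀ (one_le_regularisation_denominator β hδ k)

theorem galerkinSymbol_nonneg (m : ℕ) (k : Fin 3 → ℤ) : 0 ≤ galerkinSymbol m k := by
  unfold galerkinSymbol; split_ifs <;> norm_num

theorem galerkinSymbol_le_one (m : ℕ) (k : Fin 3 → ℤ) : galerkinSymbol m k ≤ 1 := by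
  unfold galerkinSymbol; split_ifs <;> norm_num

theorem inner_regularisation {δ : ℝ} (β : ℝ) (hδ : 0 ≤ δ) (i : ModeIndex) (v : SolenoidalSpace) :
    ⟪modeBasis i, regularisation β δ v⟫ = regularisationSymbol β δ i.1 * ⟪modeBasis i, v⟫ :=
  inner_stokesCalculus (C := 1) (fun k => by
    change |regularisationSymbol β δ k| ≤ 1
    rw [abs_of_nonneg (regularisationSymbol_nonneg β hδ k)]
    exact regularisationSymbol_le_one β hδ k) i v

theorem tendsto_regularisationSymbol {α : Type*} {l : Filter α} (β : ℝ) {δ : α → ℝ}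
    (hδ : Tendsto δ l (𝓝 0)) (k : Fin 3 → ℤ) :
    Tendsto (fun a => regularisationSymbol β (δ a) k) l (𝓝 1) := by
  have h := ((hδ.mul_const (stokesEigenvalue k ^ (2 * β))).const_add 1).inv₀ (by simp)
  simpa [regularisationSymbol] using h

theorem eventually_galerkinSymbol_eq_one {α : Type*} {l : Filter α} {m : α → ℕ}
    (hm : Tendsto m l atTop) (k : Fin 3 → ℤ) : ∀ᶠ a in l, galerkinSymbol (m a) k = 1 := by
  filter_upwards [hm.eventually_ge_atTop (∑ j, k j ^ 2).toNat] with a ha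
  refine if_pos ?_
  have h1 : ∑ j, k j ^ 2 ≤ (m a : ℤ) := (Int.self_le_toNat _).trans (by exact_mod_cast ha)
  exact h1.trans (by exact_mod_cast Nat.le_self_pow two_ne_zero _)

/-! ### Trace bounds -/

/-- The frequencies lie in a lattice of rank three, and `5 > 3`. -/
theorem summable_norm_freqVec_rpow : Summable fun k => ‖freqVec k‖ ^ (-5 : ℝ) := by
  set e := (EuclideanSpace.basisFun (Fin 3) ℝ).toBasis with he
  set L : Submodule ℤ R3 := Submodule.span ℤ (Set.range e) with hL
  have hrank : Module.finrank ℤ L = 3 := by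
    rw [ZLattice.rank ℝ L]
    simp
  have h := ZLattice.summable_norm_rpow L (-5) (by rw [hrank]; norm_num)
  have hmem : ∀ k, freqVec k ∈ L := by
    intro k
    have h1 : freqVec k = ∑ i, k i • e i := by
      ext j
      simp [freqVec, he, EuclideanSpace.basisFun_apply, Pi.single_apply]
    rw [h1]
    exact Submodule.sum_mem _ fun i _ =>
      Submodule.smul_mem _ _ (Submodule.subset_span (Set.mem_range_self i))
  refine h.comp_injective (i := fun k => (⟨freqVec k, hmem k⟩ : L)) ?_
  intro k l hkl
  have h1 : freqVec k = freqVec l := congrArg Subtype.val hkl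
  ext i
  have h2 : (freqVec k) i = (freqVec l) i := by rw [h1]
  exact_mod_cast (show (k i : ℝ) = l i from h2)

/-- Each frequency carries at most three modes. -/
theorem summable_modeIndex {w : (Fin 3 → ℤ) → ℝ} (hw0 : ∀ k, 0 ≤ w k) (hw : Summable w) :
    Summable fun i : ModeIndex => w i.1 := by
  refine (summable_sigma_of_nonneg fun i => hw0 i.1).2 ⟨fun k => ?_, ?_⟩
  · exact (hasSum_fintype _).summable
  · refine Summable.of_nonneg_of_le (fun k => tsum_nonneg fun _ => hw0 k) (fun k => ?_)
      (hw.mul_left 3)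
    dsimp only
    rw [tsum_fintype, Finset.sum_const, Finset.card_univ, Fintype.card_fin, nsmul_eq_mul]
    refine mul_le_mul_of_nonneg_right ?_ (hw0 k)
    have h1 := Submodule.finrank_le (freqPerp k)
    rw [finrank_euclideanSpace_fin] at h1
    exact_mod_cast h1

/-- The indicator function of the frequency zero. -/
def zeroFreq (k : Fin 3 → ℤ) : ℝ := if k = 0 then 1 else 0

theorem zeroFreq_nonneg (k : Fin 3 → ℤ) : 0 ≤ zeroFreq k := by
  unfold zeroFreq; split_ifs <;> norm_num

theorem summable_zeroFreq : Summable zeroFreq :=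
  summable_of_ne_finset_zero (s := {0}) fun k hk => if_neg (by simpa using hk)

/-- With `θ = 5/(4β) ≤ 1` and `x = δ E^(2β)`, one has `(1 + x)⁻¹ ≤ (1 + x)^(-θ) ≤ x^(-θ)`, and `θ`
is chosen so that `E^(-2βθ) = E^(-5/2) ≤ |k|⁻⁵`. The frequency zero needs its own term, as the real
power of zero is zero here. -/
theorem regularisationSymbol_le {β δ : ℝ} (hβ : 5 / 4 < β) (hδ : 0 < δ) (k : Fin 3 → ℤ) :
    regularisationSymbol β δ k
      ≤ zeroFreq k + δ ^ (-(5 / (4 * β))) * ‖freqVec k‖ ^ (-5 : ℝ) := by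
  have hw : 0 ≤ δ ^ (-(5 / (4 * β))) * ‖freqVec k‖ ^ (-5 : ℝ) := by positivity
  by_cases hk : k = 0
  · have := regularisationSymbol_le_one β hδ.le k
    rw [zeroFreq, if_pos hk]
    linarith
  rw [zeroFreq, if_neg hk, zero_add]
  have hn := norm_freqVec_pos hk
  have hβ0 : 0 < β := by linarith
  set θ := 5 / (4 * β) with hθ
  have hθ0 : 0 ≤ θ := by positivity
  have hθ1 : θ ≤ 1 := by
    rw [hθ, div_le_one (by positivity)]
    linarith
  set E := stokesEigenvalue k with hE
  have hEn : ‖freqVec k‖ ^ 2 ≤ E := by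
    rw [hE, stokesEigenvalue_eq]
    have h1 := Real.pi_gt_three
    exact le_mul_of_one_le_left (sq_nonneg _) (by nlinarith)
  have hE0 : 0 < E := lt_of_lt_of_le (by positivity) hEn
  have hx : 0 < δ * E ^ (2 * β) := by positivity
  calc regularisationSymbol β δ k = (1 + δ * E ^ (2 * β)) ^ (-1 : ℝ) := by
        rw [Real.rpow_neg_one]; rfl
    _ ≤ (1 + δ * E ^ (2 * β)) ^ (-θ) :=
        Real.rpow_le_rpow_of_exponent_le (by linarith) (by linarith)
    _ ≤ (δ * E ^ (2 * β)) ^ (-θ) :=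
        Real.rpow_le_rpow_of_nonpos hx (by linarith) (by linarith)
    _ = δ ^ (-θ) * E ^ (-(5 / 2) : ℝ) := by
        rw [Real.mul_rpow hδ.le (by positivity), ← Real.rpow_mul hE0.le]
        congr 2
        rw [hθ]
        field_simp
        norm_num
    _ ≤ δ ^ (-θ) * (‖freqVec k‖ ^ 2) ^ (-(5 / 2) : ℝ) := by
        gcongr ?_ * ?_
        exact Real.rpow_le_rpow_of_nonpos (by positivity) hEn (by norm_num)
    _ = δ ^ (-θ) * ‖freqVec k‖ ^ (-5 : ℝ) := by
        rw [← Real.rpow_natCast, ← Real.rpow_mul hn.le]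
        norm_num

theorem galerkinSymbol_le (m : ℕ) (k : Fin 3 → ℤ) :
    galerkinSymbol m k ≤ zeroFreq k + (m : ℝ) ^ 5 * ‖freqVec k‖ ^ (-5 : ℝ) := by
  have hw : 0 ≤ (m : ℝ) ^ 5 * ‖freqVec k‖ ^ (-5 : ℝ) := by positivity
  by_cases hk : k = 0
  · have := galerkinSymbol_le_one m k
    rw [zeroFreq, if_pos hk]
    linarith
  rw [zeroFreq, if_neg hk, zero_add, galerkinSymbol]
  split_ifs with h
  · have hn := norm_freqVec_pos hk
    have h1 : ‖freqVec k‖ ^ 2 ≤ (m : ℝ) ^ 2 := by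
      rw [norm_freqVec_sq]
      exact_mod_cast h
    have h2 : ‖freqVec k‖ ≤ m := (sq_le_sq₀ hn.le (Nat.cast_nonneg m)).1 h1
    have h3 : ‖freqVec k‖ ^ (-5 : ℝ) = (‖freqVec k‖ ^ 5)⁻¹ := by
      rw [Real.rpow_neg hn.le]
      norm_cast
    rw [h3, ← div_eq_mul_inv, one_le_div (by positivity)]
    gcongr
  · exact hw

/-- The Galerkin spaces increase and their union contains every basis mode. -/
theorem tendsto_galerkinProjection (u : SolenoidalSpace) :
    Tendsto (fun m => galerkinProjection m u) atTop (𝓝 u) := by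
  refine Submodule.starProjection_tendsto_self galerkinSpace ?_ u ?_
  · intro m n hmn
    refine Submodule.topologicalClosure_mono (Submodule.span_mono ?_)
    rintro f ⟨k, hk, hf⟩
    exact ⟨k, hk.trans (by gcongr), hf⟩
  · rw [← modeBasis.dense_span]
    refine Submodule.topologicalClosure_mono (Submodule.span_le.2 ?_)
    rintro _ ⟨i, rfl⟩
    obtain ⟨m, hm⟩ := (eventually_galerkinSymbol_eq_one tendsto_id i.1).exists
    refine (le_iSup galerkinSpace m) ?_
    rw [modeBasis_apply]
    refine casMode_mem_galerkinSpace _ ?_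
    by_contra h
    rw [id, galerkinSymbol, if_neg h] at hm
    exact zero_ne_one hm

theorem summable_zeroFreq_modeIndex : Summable fun i : ModeIndex => zeroFreq i.1 :=
  summable_modeIndex zeroFreq_nonneg summable_zeroFreq

theorem summable_norm_freqVec_modeIndex :
    Summable fun i : ModeIndex => ‖freqVec i.1‖ ^ (-5 : ℝ) :=
  summable_modeIndex (w := fun k => ‖freqVec k‖ ^ (-5 : ℝ))
    (fun _ => Real.rpow_nonneg (norm_nonneg _) _) summable_norm_freqVec_rpow

theorem summable_of_le_add_mul {κ : Type*} {q c w : κ → ℝ} {a : ℝ} (hq0 : ∀ i, 0 ≤ q i)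
    (hq : ∀ i, q i ≤ c i + a * w i) (hc : Summable c) (hw : Summable w) : Summable q :=
  Summable.of_nonneg_of_le hq0 hq (hc.add (hw.mul_left a))

theorem tsum_le_of_le_add_mul {κ : Type*} {q c w : κ → ℝ} {a : ℝ} (hq0 : ∀ i, 0 ≤ q i)
    (hq : ∀ i, q i ≤ c i + a * w i) (hc : Summable c) (hw : Summable w) :
    ∑' i, q i ≤ ∑' i, c i + a * ∑' i, w i := by
  rw [← tsum_mul_left, ← hc.tsum_add (hw.mul_left a)]
  exact (summable_of_le_add_mul hq0 hq hc hw).tsum_le_tsum hq (hc.add (hw.mul_left a))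

theorem summable_of_le_zeroFreq_add {q : (Fin 3 → ℤ) → ℝ} {a : ℝ} (hq0 : ∀ k, 0 ≤ q k)
    (hq : ∀ k, q k ≤ zeroFreq k + a * ‖freqVec k‖ ^ (-5 : ℝ)) :
    Summable fun i : ModeIndex => q i.1 :=
  summable_of_le_add_mul (fun i => hq0 i.1) (fun i => hq i.1) summable_zeroFreq_modeIndex
    summable_norm_freqVec_modeIndex

theorem tendsto_mul_trace {q : ℝ → (Fin 3 → ℤ) → ℝ} {a : ℝ → ℝ}
    (hq0 : ∀ ε, 0 < ε → ∀ k, 0 ≤ q ε k)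
    (hq : ∀ ε, 0 < ε → ∀ k, q ε k ≤ zeroFreq k + a ε * ‖freqVec k‖ ^ (-5 : ℝ))
    (ha : Tendsto (fun ε => ε * a ε) (𝓝[>] 0) (𝓝 0)) :
    Tendsto (fun ε => ε * ∑' i : ModeIndex, q ε i.1) (𝓝[>] 0) (𝓝 0) := by
  set c := ∑' i : ModeIndex, zeroFreq i.1
  set w := ∑' i : ModeIndex, ‖freqVec i.1‖ ^ (-5 : ℝ)
  have hid : Tendsto (fun ε : ℝ => ε) (𝓝[>] 0) (𝓝 0) := tendsto_id.mono_left nhdsWithin_le_nhds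
  have hlim : Tendsto (fun ε => ε * c + (ε * a ε) * w) (𝓝[>] 0) (𝓝 0) := by
    simpa using (hid.mul_const c).add (ha.mul_const w)
  refine tendsto_of_tendsto_of_tendsto_of_le_of_le' tendsto_const_nhds hlim ?_ ?_
  · filter_upwards [self_mem_nhdsWithin] with ε hε
    exact mul_nonneg (le_of_lt hε) (tsum_nonneg fun i => hq0 ε hε i.1)
  · filter_upwards [self_mem_nhdsWithin] with ε hε
    have h := mul_le_mul_of_nonneg_left (tsum_le_of_le_add_mul (fun i : ModeIndex => hq0 ε hε i.1)
      (fun i => hq ε hε i.1) summable_zeroFreq_modeIndex summable_norm_freqVec_modeIndex)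
      (le_of_lt hε)
    refine h.trans (le_of_eq ?_)
    ring

theorem galerkinSymbol_mul_regularisationSymbol_le {β δ : ℝ} (hβ : 5 / 4 < β) (hδ : 0 ≤ δ) (m : ℕ)
    (k : Fin 3 → ℤ) :
    galerkinSymbol m k * regularisationSymbol β δ k ≤ zeroFreq k +
      (min ((m : ℝ≥0∞) ^ 5) (ENNReal.ofReal δ ^ (-(5 / (4 * β))))).toReal
        * ‖freqVec k‖ ^ (-5 : ℝ) := by
  have hg0 := galerkinSymbol_nonneg m k
  have hg1 := galerkinSymbol_le_one m k
  have hr0 := regularisationSymbol_nonneg β hδ k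
  have hr1 := regularisationSymbol_le_one β hδ k
  rcases le_or_gt ((m : ℝ≥0∞) ^ 5) (ENNReal.ofReal δ ^ (-(5 / (4 * β)))) with h | h
  · rw [min_eq_left h, ENNReal.toReal_pow, ENNReal.toReal_natCast]
    exact (mul_le_of_le_one_right hg0 hr1).trans (galerkinSymbol_le m k)
  · have hθ : -(5 / (4 * β)) < 0 := neg_neg_of_pos (by have : 0 < β := by linarith
                                                       positivity)
    -- If `δ = 0`, the negative power is `⊤` and cannot be the smaller term.
    have hδ0 : 0 < δ := by
      rcases hδ.eq_or_lt with h0 | h0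
      · rw [← h0, ENNReal.ofReal_zero, ENNReal.zero_rpow_of_neg hθ] at h
        exact absurd h not_top_lt
      · exact h0
    rw [min_eq_right h.le, ENNReal.ofReal_rpow_of_pos hδ0, ENNReal.toReal_ofReal (by positivity)]
    exact (mul_le_of_le_one_left hr0 hg1).trans (regularisationSymbol_le hβ hδ0 k)

end

theorem lemma1p2 (β : ℝ) (hβ : 5 / 4 < β) (u₀ : SolenoidalSpace) :
    (∀ δ : ℝ → ℝ, (∀ ε, 0 < ε → 0 < δ ε) → Tendsto δ (𝓝[>] 0) (𝓝 0) →
      Tendsto (fun ε : ℝ => ε * δ ε ^ (-(5 / (4 * β)))) (𝓝[>] 0) (𝓝 0) →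
      InitialDataAssumption
        (fun ε => gaussianMeasure u₀ (fun h => (ε / 2) • regularisation β (δ ε) h))
        (fun v => ENNReal.ofReal (‖v - u₀‖ ^ 2))) ∧
    (∀ (δ : ℝ → ℝ) (m : ℝ → ℕ), (∀ ε, 0 < ε → 0 ≤ δ ε) → Tendsto δ (𝓝[>] 0) (𝓝 0) →
      Tendsto m (𝓝[>] 0) atTop →
      Tendsto (fun ε : ℝ => ENNReal.ofReal ε *
        min ((m ε : ℝ≥0∞) ^ 5) (ENNReal.ofReal (δ ε) ^ (-(5 / (4 * β))))) (𝓝[>] 0) (𝓝 0) →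
      InitialDataAssumption
        (fun ε => gaussianMeasure (galerkinProjection (m ε) u₀)
          (fun h => (ε / 2) • galerkinProjection (m ε) (regularisation β (δ ε) h)))
        (fun v => ENNReal.ofReal (‖v - u₀‖ ^ 2))) := by
  constructor
  · intro δ hδ hδ0 hlim
    refine initialDataAssumption_of_diagonal modeBasis (u := fun _ => u₀)
      (q := fun ε i => regularisationSymbol β (δ ε) i.1) (Q := fun ε => regularisation β (δ ε))
      (fun ε hε i v => inner_regularisation β (hδ ε hε).le i v)
      (fun ε hε i => regularisationSymbol_nonneg β (hδ ε hε).le i.1)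
      (fun ε hε i => regularisationSymbol_le_one β (hδ ε hε).le i.1)
      (fun ε hε => summable_of_le_zeroFreq_add
        (fun k => regularisationSymbol_nonneg β (hδ ε hε).le k)
        (fun k => regularisationSymbol_le hβ (hδ ε hε) k))
      tendsto_const_nhds (fun i => tendsto_regularisationSymbol β hδ0 i.1) ?_
    exact tendsto_mul_trace (q := fun ε => regularisationSymbol β (δ ε))
      (fun ε hε k => regularisationSymbol_nonneg β (hδ ε hε).le k)
      (fun ε hε k => regularisationSymbol_le hβ (hδ ε hε) k) hlim
  · intro δ m hδ hδ0 hm hlim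
    have hq0 : ∀ ε, 0 < ε → ∀ k, 0 ≤ galerkinSymbol (m ε) k * regularisationSymbol β (δ ε) k :=
      fun ε hε k => mul_nonneg (galerkinSymbol_nonneg _ k)
        (regularisationSymbol_nonneg β (hδ ε hε) k)
    have hle := fun ε hε => galerkinSymbol_mul_regularisationSymbol_le hβ (hδ ε hε) (m ε)
    refine initialDataAssumption_of_diagonal modeBasis (u := fun ε => galerkinProjection (m ε) u₀)
      (q := fun ε i => galerkinSymbol (m ε) i.1 * regularisationSymbol β (δ ε) i.1)
      (Q := fun ε h => galerkinProjection (m ε) (regularisation β (δ ε) h))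
      (fun ε hε i v => ?_) (fun ε hε i => hq0 ε hε i.1)
      (fun ε hε i => mul_le_one₀ (galerkinSymbol_le_one _ _)
        (regularisationSymbol_nonneg β (hδ ε hε) _) (regularisationSymbol_le_one β (hδ ε hε) _))
      (fun ε hε => summable_of_le_zeroFreq_add (hq0 ε hε) (hle ε hε))
      ((tendsto_galerkinProjection u₀).comp hm) (fun i => ?_) ?_
    · rw [inner_galerkinProjection, inner_regularisation β (hδ ε hε), ← mul_assoc]
      rfl
    · refine (tendsto_regularisationSymbol β hδ0 i.1).congr' ?_
      filter_upwards [eventually_galerkinSymbol_eq_one hm i.1] with ε h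
      rw [h, one_mul]
    · refine tendsto_mul_trace
        (q := fun ε k => galerkinSymbol (m ε) k * regularisationSymbol β (δ ε) k) hq0 hle ?_
      have h1 := (ENNReal.tendsto_toReal ENNReal.zero_ne_top).comp hlim
      rw [ENNReal.toReal_zero] at h1
      refine h1.congr' ?_
      filter_upwards [self_mem_nhdsWithin] with ε hε
      rw [Function.comp_apply, ENNReal.toReal_mul, ENNReal.toReal_ofReal (le_of_lt hε)]
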